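/- Let $X=\{0,1\}$, let $X^\infty$ be the set of infinite words over $X$, and let $a,b$ be the permutations of $X^\infty$ defined by $a(0w)=1w$, $a(1w)=0\,a(w)$, $b(0w)=0\,b(w)$, $b(1w)=1\,a(w)$ (the two nontrivial states of the 3-state automaton $a=(e,a)\sigma$, $b=(b,a)$). Let $\mathcal G=\langle a,b\rangle$, let $\omega=(01)^\infty=010101\ldots$, and let $\Gamma=\Gamma_{(01)^\infty}$ be the Schreier graph of the action of $\mathcal G$ on the orbit $\mathcal G\omega$ with respect to $\{a,b\}$: its vertices are the points of the orbit, and for each vertex $x$ and each $s\in\{a,b\}$ there is an edge labelled $s$ from $x$ to $s(x)$. For a vertex $x$ let $B(x,n)$ be the ball of radius $n$ about $x$ in $\Gamma$ (orientation ignored). A graph with vertex set $V$ and edges labelled by a finite set $S$ is *automatic* if there are a finite alphabet $Y$ and an injective map $v\mapsto\overline v$ from $V$ to $Y^*$ such that $\overline V$ is a regular language and, for each $s\in S$, the language of all convolutions $\otimes(\overline v,\overline{v'})$, where $(v,v')$ runs over the edges labelled $s$, is regular; here $\otimes(u,u')$ is the word of length $\max(|u|,|u'|)$ whose $j$-th letter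 is the pair of the $j$-th letters of $u$ and $u'$, a missing letter being replaced by a padding symbol $\diamond\notin Y$. **Theorem.** There exists an infinite 4-regular automatic graph of intermediate growth. More precisely, $\Gamma=\Gamma_{(01)^\infty}$ is infinite; each of its vertices is incident to exactly four edges (incoming and outgoing together) and has exactly four distinct neighbours different from itself; $\Gamma$ is automatic; and for every vertex $x$ the growth function $n\mapsto|B(x,n)|$ is intermediate, i.e. $n^d=o(|B(x,n)|)$ for every $d\in\mathbb N$ and $|B(x,n)|=o(c^n)$ for every real $c>1$. Quantitatively, for every vertex $x$: * for every $\varepsilon>0$, $\;n^{(\frac12-\varepsilon)\log_2 n}\le|B(x,n)|$ for all sufficiently large $n$; * there is a constant $C>0$ with $|B(x,n)|\le C\,n^{\log_2 n}$ for all $n\ge1$. -/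

import Mathlib

open Filter Asymptotics

/-! ### Invertible Mealy automata and their action on infinite words -/

/-- An invertible Mealy automaton with states `Q` over the alphabet `X`: in state `q` it reads a
letter `x`, prints `out q x` and moves to the state `next q x`; every `out q` is a permutation. -/
structure InvertibleMealy (Q X : Type*) where
  next : Q → X → Q
  out : Q → Equiv.Perm X

namespace InvertibleMealy

variable {Q X : Type*}

/-- The state of the automaton started at `q` after it has read the first `n` letters of `w`. -/
def stateAt (A : InvertibleMealy Q X) (q : Q) (w : ℕ → X) : ℕ → Q
  | 0 => q
  | n + 1 => A.next (stateAt A q w n) (w n)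

/-- The transformation of infinite words induced by the initial automaton with initial state
`q`. -/
def act (A : InvertibleMealy Q X) (q : Q) (w : ℕ → X) : ℕ → X :=
  fun n => A.out (A.stateAt q w n) (w n)

/-- The inverse automaton (input and output letters exchanged). -/
def inverse (A : InvertibleMealy Q X) : InvertibleMealy Q X where
  next q y := A.next q ((A.out q).symm y)
  out q := (A.out q).symm

theorem stateAt_inverse_act (A : InvertibleMealy Q X) (q : Q) (w : ℕ → X) (n : ℕ) :
    A.inverse.stateAt q (A.act q w) n = A.stateAt q w n := by
  induction n with
  | zero => rfl
  | succ n ih => simp only [stateAt, ih]; simp [inverse, act]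

theorem inverse_act_act (A : InvertibleMealy Q X) (q : Q) (w : ℕ → X) :
    A.inverse.act q (A.act q w) = w := by
  funext n
  show A.inverse.out (A.inverse.stateAt q (A.act q w) n) (A.act q w n) = w n
  rw [stateAt_inverse_act]
  simp [inverse, act]

theorem inverse_inverse (A : InvertibleMealy Q X) : A.inverse.inverse = A := by
  simp [inverse]

/-- The transformation induced by a state, as a permutation of the set of infinite words. -/
def perm (A : InvertibleMealy Q X) (q : Q) : Equiv.Perm (ℕ → X) where
  toFun := A.act q
  invFun := A.inverse.act q
  left_inv w := A.inverse_act_act q w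
  right_inv w := by
    have h := A.inverse.inverse_act_act q w
    rwa [inverse_inverse] at h

end InvertibleMealy

/-! ### Labelled graphs -/

/-- An oriented graph with vertex set `V` whose edges are labelled by elements of `S`, given as the
system of binary relations `Edge s`, `s ∈ S`, on `V`. -/
structure LabeledGraph (V S : Type*) where
  Edge : S → V → V → Prop

namespace LabeledGraph

variable {V S : Type*}

/-- The simple graph obtained by forgetting labels, orientation, loops and multiplicities. -/
def toSimpleGraph (Γ : LabeledGraph V S) : SimpleGraph V :=
  SimpleGraph.fromRel fun x y => ∃ s, Γ.Edge s x y

/-- The degree of a vertex: the number of outgoing plus the number of incoming edges, so that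
edges are counted with multiplicity and loops are counted twice. -/
noncomputable def degree (Γ : LabeledGraph V S) (x : V) : ℕ∞ :=
  {p : S × V | Γ.Edge p.1 x p.2}.encard + {p : S × V | Γ.Edge p.1 p.2 x}.encard

/-- The ball of radius `n` centered at `x`; orientation of edges is ignored. -/
def ball (Γ : LabeledGraph V S) (x : V) (n : ℕ) : Set V :=
  {y | Γ.toSimpleGraph.edist x y ≤ n}

/-- The growth function of a (locally finite) graph with base point `x`. -/
noncomputable def growth (Γ : LabeledGraph V S) (x : V) (n : ℕ) : ℕ :=
  (Γ.ball x n).ncard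

end LabeledGraph

/-- `f` is of intermediate growth: it grows faster than every polynomial and slower than every
exponential function. -/
def IsIntermediateGrowth (f : ℕ → ℕ) : Prop :=
  (∀ d : ℕ, (fun n : ℕ => (n : ℝ) ^ d) =o[atTop] fun n : ℕ => (f n : ℝ)) ∧
    ∀ c : ℝ, 1 < c → (fun n : ℕ => (f n : ℝ)) =o[atTop] fun n : ℕ => c ^ n

/-- The Schreier graph of an action of `G` on `M` with respect to `S`: there is an edge labelled
`s` from `x` to `y` if and only if `s` maps `x` to `y`. -/
def schreierGraph {G : Type*} [Group G] (S : Set G) (M : Type*) [MulAction G M] :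
    LabeledGraph M S where
  Edge s x y := (s : G) • x = y

/-! ### Automatic graphs -/

/-- The convolution `⊗(u, v)` of two words: the `j`-th letter is the pair of the `j`-th letters of
`u` and `v`, where `none` is the padding symbol `⋄`. -/
def convolution {X : Type*} (u v : List X) : List (Option X × Option X) :=
  (List.range (max u.length v.length)).map fun j => (u[j]?, v[j]?)

/-- A binary relation on words is regular if its convolution is a regular language. -/
def IsRegularRel {X : Type*} (R : List X → List X → Prop) : Prop :=
  Language.IsRegular
    ({w | ∃ u v, R u v ∧ convolution u v = w} : Language (Option X × Option X))

/-- A graph with finite label set is automatic if its vertices can be encoded injectively by words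
over a finite alphabet such that the language of codes and the relations induced on codes by the
labelled edges are all regular. -/
def LabeledGraph.IsAutomatic {V S : Type*} [Finite S] (Γ : LabeledGraph V S) : Prop :=
  ∃ (X : Type) (_ : Finite X) (code : V → List X),
    Function.Injective code ∧
    Language.IsRegular (Set.range code : Language X) ∧
    ∀ s : S, IsRegularRel (Relation.Map (Γ.Edge s) code code)

/-! ### The graph `Γ_{(01)^∞}` -/

/-- The states of the three-state automaton. -/
inductive AState
  | e
  | a
  | b

/-- The automaton with wreath recursion `e = (e, e)`, `a = (e, a)σ`, `b = (b, a)`. -/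
def automatonA : InvertibleMealy AState (Fin 2) where
  next
    | .e, _ => .e
    | .a, 0 => .e
    | .a, 1 => .a
    | .b, 0 => .b
    | .b, 1 => .a
  out
    | .e => Equiv.refl _
    | .a => Equiv.swap 0 1
    | .b => Equiv.refl _

/-- The group generated by the nontrivial states `a` and `b`, as a group of permutations of
`{0,1}^∞`. (It acts faithfully there, and the remaining state `e` is the identity.) -/
def groupG : Subgroup (Equiv.Perm (ℕ → Fin 2)) :=
  Subgroup.closure {automatonA.perm .a, automatonA.perm .b}

/-- The generator `a`. -/
def genA : groupG := ⟨automatonA.perm .a, Subgroup.subset_closure (Or.inl rfl)⟩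

/-- The generator `b`. -/
def genB : groupG := ⟨automatonA.perm .b, Subgroup.subset_closure (Or.inr rfl)⟩

/-- The infinite word `(01)^∞ = 010101…`. -/
def word01 : ℕ → Fin 2 := fun n => if n % 2 = 0 then 0 else 1

/-- The orbital Schreier graph `Γ_ω`: the Schreier graph of the action of the group on the orbit
of `ω`, with respect to the generators `a`, `b`. -/
def orbitalGraph (ω : ℕ → Fin 2) :
    LabeledGraph (MulAction.orbit groupG ω) ({genA, genB} : Set groupG) :=
  schreierGraph {genA, genB} (MulAction.orbit groupG ω)

/-!
The word `(01)^∞`, read as a `2`-adic integer, is `-2 / 3`. The generator `a` adds `1`, and `b` maps a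
nonzero `2`-adic integer `x` of valuation `v` to `x + 2 ^ (v + 1)`. Hence the orbit of `(01)^∞` is
`-2 / 3 + ℤ`, and the graph is, up to labels and orientation, `modelGraph`: the graph on `ℤ` in which
`n` is joined to `n ± 1` and `n ± 2 ^ (level n + 1)`, where `level n` is the valuation of `n - 2 / 3`.
These four neighbours are distinct. The arithmetic is done with residues modulo `2 ^ k`, the
numbers `prefixVal w k`.

The growth estimates come from the scales `2 ^ tri t`, where `tri t = t * (t + 1) / 2`. Two vertices
of level at least `k` differ by a multiple of `2 ^ k`, and a path avoiding them has steps of size at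
most `2 ^ k`. An excursion between two distinct vertices of level at least `tri t` either visits level
`tri (t - 1)` and then contains two excursions of the previous scale, or it needs `2 ^ t` steps of
size at most `2 ^ tri (t - 1)`; so it takes at least `2 ^ t` steps (`two_pow_le_of_excursion`). As
`n - 2 / 3` is never zero, vertices of high level are far from a given vertex, and a ball of radius
`2 ^ t` stays in an interval of length `2 ^ (t ^ 2 / 2 + O(t))`; this gives the upper bound.
Conversely, vertices at most `2 ^ tri t` apart can be joined by going to nearby vertices of level exactly
`tri (t - 1)` and jumping from one to the other, whence a path of length `(t + 1) * 2 ^ t`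
(`edist_le_of_abs_sub_le`); this gives the lower bound.

For automaticity, all points of the orbit agree with `(01)^∞` from some place on and, conversely, all
such words are in the orbit. A vertex is encoded by the finite `0`-`1` word that marks the differences
with `(01)^∞` and does not end in `0`. An edge is then recognized by running the automaton on the first
component of the convolution (`mem_accepts_transducerDFA`); the computation is complete when
the state `e` is reached, since the states `a` and `b` change every tail of `(01)^∞`.
-/

/-! ### The model graph on the integers -/

/-- The level of the integer `n`: the `2`-adic valuation of `3 * n - 2`, that is, of the `2`-adic
integer `n - 2 / 3`. -/
def level (n : ℤ) : ℕ := padicValInt 2 (3 * n - 2)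

theorem pow_dvd_iff_le_level {k : ℕ} {n : ℤ} : 2 ^ k ∣ 3 * n - 2 ↔ k ≤ level n := by
  have h := padicValInt_dvd_iff (p := 2) k (3 * n - 2)
  have h0 : 3 * n - 2 ≠ 0 := by omega
  simpa [h0, level] using h

theorem level_eq_iff {k : ℕ} {n : ℤ} :
    level n = k ↔ 2 ^ k ∣ 3 * n - 2 ∧ ¬ 2 ^ (k + 1) ∣ 3 * n - 2 := by
  rw [pow_dvd_iff_le_level, pow_dvd_iff_le_level]; omega

theorem level_add_mul {k : ℕ} {n : ℤ} (h : level n = k) (m : ℤ) :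
    level (n + 2 ^ (k + 1) * m) = k := by
  have e : 3 * (n + 2 ^ (k + 1) * m) - 2 = (3 * n - 2) + 2 ^ (k + 1) * (3 * m) := by ring
  rw [level_eq_iff] at h ⊢
  rw [e]
  refine ⟨dvd_add h.1 ((pow_dvd_pow 2 k.le_succ).mul_right _), fun h' => h.2 ?_⟩
  exact (dvd_add_left (dvd_mul_right _ _)).1 h'

theorem pow_dvd_sub_of_le_level {k : ℕ} {m n : ℤ} (hm : k ≤ level m) (hn : k ≤ level n) :
    (2 : ℤ) ^ k ∣ n - m := by
  have h := dvd_sub (pow_dvd_iff_le_level.2 hn) (pow_dvd_iff_le_level.2 hm)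
  have e : 3 * n - 2 - (3 * m - 2) = 3 * (n - m) := by ring
  rw [e] at h
  refine IsCoprime.dvd_of_dvd_mul_left ?_ h
  exact IsCoprime.pow_left ⟨-1, 1, by norm_num⟩

theorem pow_le_abs_sub_of_le_level {k : ℕ} {m n : ℤ} (hm : k ≤ level m) (hn : k ≤ level n)
    (hne : m ≠ n) : (2 : ℤ) ^ k ≤ |n - m| :=
  Int.le_of_dvd (abs_pos.2 (sub_ne_zero.2 hne.symm))
    ((dvd_abs _ _).2 (pow_dvd_sub_of_le_level hm hn))

theorem level_eq_of_abs_sub {m n : ℤ} (h : |n - m| = 2 ^ (level m + 1)) : level n = level m := by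
  rcases abs_eq (by positivity) |>.1 h with h | h
  · have := level_add_mul (n := m) rfl 1
    rwa [mul_one, ← h, add_sub_cancel] at this
  · have := level_add_mul (n := m) rfl (-1)
    rwa [mul_neg_one, ← h, add_sub_cancel] at this

/-- The graph on `ℤ` in which `n` is joined to `n ± 1` and to `n ± 2 ^ (level n + 1)`. -/
def modelGraph : SimpleGraph ℤ where
  Adj m n := |n - m| = 1 ∨ |n - m| = 2 ^ (level m + 1)
  symm := ⟨fun m n h => by
    rcases h with h | h
    · left; rwa [abs_sub_comm]
    · right; rwa [level_eq_of_abs_sub h, abs_sub_comm]⟩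
  loopless := ⟨fun m h => by
    rw [sub_self, abs_zero] at h
    rcases h with h | h
    · omega
    · exact (pow_ne_zero _ two_ne_zero) h.symm⟩

theorem modelGraph_adj {m n : ℤ} :
    modelGraph.Adj m n ↔ |n - m| = 1 ∨ |n - m| = 2 ^ (level m + 1) := Iff.rfl

/-- A step with an endpoint of level less than `k` has size at most `2 ^ k`. -/
theorem abs_sub_le_of_adj {k : ℕ} {m n : ℤ} (h : modelGraph.Adj m n)
    (hk : level m < k ∨ level n < k) : |n - m| ≤ 2 ^ k := by
  rcases h with h | h
  · rw [h]; exact one_le_pow₀ one_le_two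
  · rw [level_eq_of_abs_sub h, or_self] at hk
    rw [h]; exact pow_le_pow_right₀ one_le_two hk

/-- An edge between two vertices of positive level preserves the level. -/
theorem level_eq_of_adj {m n : ℤ} (h : modelGraph.Adj m n) (hm : 1 ≤ level m)
    (hn : 1 ≤ level n) : level n = level m := by
  rcases h with h | h
  · have := pow_le_abs_sub_of_le_level hm hn (by rintro rfl; simp at h)
    omega
  · exact level_eq_of_abs_sub h

/-- A sequence of `b - a` steps, each of size at most `M`, moves by at most `(b - a) * M`. -/
theorem abs_sub_le_mul_of_steps {s : ℕ → ℤ} {M : ℤ} {a b : ℕ} (hab : a ≤ b)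
    (h : ∀ i, a ≤ i → i < b → |s (i + 1) - s i| ≤ M) : |s b - s a| ≤ (b - a : ℕ) * M := by
  induction b, hab using Nat.le_induction with
  | base => simp
  | succ b hab ih =>
    have h1 := ih fun i hi hib => h i hi (by omega)
    have h2 := h b hab (by omega)
    have h3 := abs_sub_le (s (b + 1)) (s b) (s a)
    have e : ((b + 1 - a : ℕ) : ℤ) = (b - a : ℕ) + 1 := by omega
    rw [e, add_mul, one_mul]
    linarith

/-- The triangular number `0 + 1 + ... + t`. -/
def tri (t : ℕ) : ℕ := (t + 1).choose 2

theorem tri_zero : tri 0 = 0 := rfl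

theorem tri_succ (t : ℕ) : tri (t + 1) = tri t + (t + 1) := by
  rw [tri, Nat.choose_succ_succ', Nat.choose_one_right, add_comm, tri]

theorem two_mul_tri (t : ℕ) : 2 * tri t = t * (t + 1) := by
  induction t with
  | zero => rfl
  | succ t ih => rw [tri_succ, mul_add, ih]; ring

/-! ### Slow escape: distances in the model graph from below -/

/-- The last time before `b` at which a property holds. -/
theorem exists_last_lt {P : ℕ → Prop} {a b : ℕ} (hab : a < b) (ha : P a) :
    ∃ c, a ≤ c ∧ c < b ∧ P c ∧ ∀ i, c < i → i < b → ¬ P i := by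
  induction b, hab using Nat.le_induction with
  | base => exact ⟨a, le_rfl, by omega, ha, fun i h1 h2 => by omega⟩
  | succ b hab ih =>
    by_cases hb : P b
    · exact ⟨b, by omega, by omega, hb, fun i h1 h2 => by omega⟩
    · obtain ⟨c, h1, h2, h3, h4⟩ := ih
      refine ⟨c, h1, by omega, h3, fun i hi1 hi2 => ?_⟩
      rcases Nat.lt_succ_iff_lt_or_eq.1 hi2 with h | rfl
      · exact h4 i hi1 h
      · exact hb

/-- A path that leaves the set of vertices of level at least `tri t` and returns to another vertex
of that set takes at least `2 ^ t` steps. If the interior of the path avoids the vertices of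
level at least `tri (t - 1)`, then its steps have size at most `2 ^ tri (t - 1)`, while its endpoints
are at least `2 ^ tri t` apart; otherwise its initial and its final part are two such paths one
stage below. -/
theorem two_pow_le_of_excursion {t : ℕ} (ht : 1 ≤ t) {s : ℕ → ℤ} {a b : ℕ} (hab : a + 2 ≤ b)
    (hs : ∀ i, a ≤ i → i < b → modelGraph.Adj (s i) (s (i + 1)))
    (ha : tri t ≤ level (s a)) (hb : tri t ≤ level (s b)) (hne : s a ≠ s b)
    (hi : ∀ i, a < i → i < b → level (s i) < tri t) : 2 ^ t ≤ b - a := by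
  induction t, ht using Nat.le_induction generalizing a b with
  | base => omega
  | succ t ht ih =>
    have ht0 : 1 ≤ tri t := by
      obtain ⟨u, rfl⟩ := Nat.exists_eq_add_of_le ht
      rw [add_comm, tri_succ]; omega
    have hT := tri_succ t
    by_cases hc : ∃ c, a < c ∧ c < b ∧ tri t ≤ level (s c)
    · classical
      obtain ⟨h1, h2, h3⟩ := Nat.find_spec hc
      have hmin := fun i (h : i < Nat.find hc) => Nat.find_min hc h
      set c := Nat.find hc
      obtain ⟨d, k1, k2, k3, k4⟩ := exists_last_lt (P := fun i => tri t ≤ level (s i)) h2 h3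
      have hac : a + 2 ≤ c := by
        by_contra hlt
        have e : c = a + 1 := by omega
        have := level_eq_of_adj (hs a le_rfl (by omega)) (by omega) (by rw [← e]; omega)
        have := hi c h1 h2
        rw [e] at this
        omega
      have hdb : d + 2 ≤ b := by
        by_contra hlt
        have e : b = d + 1 := by omega
        have := level_eq_of_adj (hs d (by omega) (by omega)) (by omega) (by rw [← e]; omega)
        have := hi d (by omega) k2
        rw [← e] at *
        omega
      have g1 := ih hac (fun i p q => hs i p (by omega)) (by omega) h3
        (fun h => by have := hi c h1 h2; rw [← h] at this; omega)
        (fun i p q => by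
          by_contra hh
          exact hmin i q ⟨p, by omega, by omega⟩)
      have g2 := ih hdb (fun i p q => hs i (by omega) q) k3 (by omega)
        (fun h => by have := hi d (by omega) k2; rw [h] at this; omega)
        (fun i p q => not_le.1 (k4 i p q))
      rw [pow_succ]; omega
    · push Not at hc
      have h1 : |s b - s a| ≤ (b - a : ℕ) * 2 ^ tri t := by
        refine abs_sub_le_mul_of_steps (by omega) fun i p q => ?_
        refine abs_sub_le_of_adj (hs i p q) ?_
        rcases p.eq_or_lt with rfl | p
        · exact Or.inr (hc _ (by omega) (by omega))
        · exact Or.inl (hc _ p q)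
      have h2 := (pow_le_abs_sub_of_le_level ha hb hne).trans h1
      rw [hT, pow_add, mul_comm] at h2
      have h3 := le_of_mul_le_mul_right h2 (by positivity)
      exact_mod_cast h3

/-- A path that starts far away from all vertices of level at least `tri (t + 1)` needs many steps
to reach one of them: it contains an excursion from level `tri t`, or all its steps are short. -/
theorem two_pow_le_of_hits {t : ℕ} (ht : 1 ≤ t) {s : ℕ → ℤ} {N : ℕ}
    (hs : ∀ i, i < N → modelGraph.Adj (s i) (s (i + 1)))
    (hfar : ∀ y, tri (t + 1) ≤ level y → (2 : ℤ) ^ tri (t + 1) ≤ 4 * |y - s 0|)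
    (hN : tri (t + 1) ≤ level (s N)) : 2 ^ t ≤ 2 * (2 * N) := by
  classical
  have hex : ∃ n, tri (t + 1) ≤ level (s n) := ⟨N, hN⟩
  have hmin := fun i (h : i < Nat.find hex) => Nat.find_min hex h
  have hspec := Nat.find_spec hex
  have hle : Nat.find hex ≤ N := Nat.find_min' hex hN
  set M := Nat.find hex
  have hT := tri_succ t
  have ht0 : 1 ≤ tri t := by
    obtain ⟨u, rfl⟩ := Nat.exists_eq_add_of_le ht
    rw [add_comm, tri_succ]; omega
  by_cases hc : ∃ c, c < M ∧ tri t ≤ level (s c)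
  · obtain ⟨c, h1, h2⟩ := hc
    obtain ⟨d, k1, k2, k3, k4⟩ := exists_last_lt (P := fun i => tri t ≤ level (s i)) h1 h2
    have hd := hmin d k2
    have hdM : d + 2 ≤ M := by
      by_contra hlt
      have e : M = d + 1 := by omega
      have := level_eq_of_adj (hs d (by omega)) (by omega) (by rw [← e]; omega)
      rw [← e] at this
      omega
    have := two_pow_le_of_excursion ht hdM (fun i p q => hs i (by omega)) k3 (by omega)
      (fun h => hd (by rw [h]; exact hspec)) (fun i p q => not_le.1 (k4 i p q))
    omega
  · push Not at hc
    have h1 : |s M - s 0| ≤ (M - 0 : ℕ) * 2 ^ tri t := by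
      refine abs_sub_le_mul_of_steps (by omega) fun i p q => ?_
      exact abs_sub_le_of_adj (hs i (by omega)) (Or.inl (hc i q))
    have h2 : (2 : ℤ) ^ (t + 1) * 2 ^ tri t ≤ (4 * M : ℤ) * 2 ^ tri t := by
      have := hfar _ hspec
      rw [hT, add_comm, pow_add] at this
      rw [Nat.sub_zero] at h1
      linarith
    have h3 := le_of_mul_le_mul_right h2 (by positivity)
    have h4 : 2 ^ (t + 1) ≤ 4 * M := by exact_mod_cast h3
    rw [pow_succ] at h4
    omega

/-- Vertices of high level are far away from a given vertex, because `3 * y - 2` does not vanish at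
integers. -/
theorem pow_le_four_mul_abs_sub {k : ℕ} {x y : ℤ} (hx : 4 * |3 * x - 2| ≤ 2 ^ k)
    (hy : k ≤ level y) : (2 : ℤ) ^ k ≤ 4 * |y - x| := by
  have h1 := Int.le_of_dvd (abs_pos.2 (by omega)) ((dvd_abs _ _).2 (pow_dvd_iff_le_level.2 hy))
  have h2 := abs_add_le (3 * (y - x)) (3 * x - 2)
  rw [abs_mul, abs_of_pos (by norm_num : (0 : ℤ) < 3)] at h2
  have e : 3 * (y - x) + (3 * x - 2) = 3 * y - 2 := by ring
  rw [e] at h2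
  linarith

/-- The vertices at distance at most `n < 2 ^ (t - 2)` from `x` lie in an interval of radius
`n * 2 ^ tri (t + 1)` around `x`. -/
theorem abs_sub_le_of_edist_le {t n : ℕ} (ht : 1 ≤ t) {x y : ℤ}
    (hx : 4 * |3 * x - 2| ≤ 2 ^ tri (t + 1)) (hn : 4 * n < 2 ^ t)
    (hxy : modelGraph.edist x y ≤ n) : |y - x| ≤ n * 2 ^ tri (t + 1) := by
  obtain ⟨p, hp⟩ := SimpleGraph.exists_walk_of_edist_ne_top (ne_top_of_le_ne_top (by simp) hxy)
  rw [← hp, Nat.cast_le] at hxy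
  have hadj : ∀ i, i < p.length → modelGraph.Adj (p.getVert i) (p.getVert (i + 1)) :=
    fun i hi => p.adj_getVert_succ hi
  have hlev : ∀ i, i ≤ p.length → level (p.getVert i) < tri (t + 1) := by
    intro i hi
    by_contra hlt
    have := two_pow_le_of_hits ht (s := p.getVert) (fun j hj => hadj j (by omega))
      (fun y hy => by simpa using pow_le_four_mul_abs_sub hx hy) (not_lt.1 hlt)
    omega
  have h1 : |p.getVert p.length - p.getVert 0| ≤ (p.length - 0 : ℕ) * 2 ^ tri (t + 1) :=
    abs_sub_le_mul_of_steps (Nat.zero_le _) fun i _ hi =>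
      abs_sub_le_of_adj (hadj i hi) (Or.inl (hlev i hi.le))
  simp only [SimpleGraph.Walk.getVert_length, SimpleGraph.Walk.getVert_zero, Nat.sub_zero] at h1
  refine h1.trans ?_
  gcongr

/-! ### Fast connections: distances in the model graph from above -/

theorem edist_add_mul_le {k : ℕ} {x : ℤ} (hx : level x = k) (m : ℕ) :
    modelGraph.edist x (x + 2 ^ (k + 1) * m) ≤ m := by
  induction m with
  | zero => simp
  | succ m ih =>
    refine (SimpleGraph.edist_triangle (v := x + 2 ^ (k + 1) * (m : ℤ))).trans ?_
    rw [Nat.cast_add (R := ℕ∞), Nat.cast_one]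
    refine add_le_add ih (SimpleGraph.edist_le_one_iff_adj_or_eq.2 (Or.inl (Or.inr ?_)))
    rw [level_add_mul hx]
    push_cast
    rw [mul_add, mul_one, ← add_assoc, add_sub_cancel_left, abs_of_pos (by positivity)]

/-- Every level occurs. -/
theorem exists_level_eq (k : ℕ) : ∃ z, level z = k := by
  have key : ∃ z ε : ℤ, 3 * z - 2 = 2 ^ k * ε ∧ (ε = 1 ∨ ε = -1) := by
    have h4 : ∀ j : ℕ, ∃ c : ℤ, (4 : ℤ) ^ j = 3 * c + 1 := by
      intro j
      induction j with
      | zero => exact ⟨0, by norm_num⟩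
      | succ j ih => obtain ⟨c, hc⟩ := ih; exact ⟨4 * c + 1, by rw [pow_succ, hc]; ring⟩
    rcases Nat.even_or_odd' k with ⟨j, rfl | rfl⟩ <;> obtain ⟨c, hc⟩ := h4 j
    · refine ⟨c + 1, 1, ?_, Or.inl rfl⟩
      rw [pow_mul]; norm_num; rw [hc]; ring
    · refine ⟨-2 * c, -1, ?_, Or.inr rfl⟩
      rw [pow_succ, pow_mul]; norm_num; rw [hc]; ring
  obtain ⟨z, ε, hz, hε⟩ := key
  refine ⟨z, level_eq_iff.2 ?_⟩
  rw [hz]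
  refine ⟨dvd_mul_right _ _, fun h => ?_⟩
  rw [pow_succ, mul_dvd_mul_iff_left (by positivity)] at h
  omega

theorem exists_near_residue (k : ℕ) (z x : ℤ) :
    ∃ m : ℤ, |z + 2 ^ (k + 1) * m - x| ≤ 2 ^ k := by
  refine ⟨(x - z).bdiv (2 ^ (k + 1)), ?_⟩
  have h := Int.bmod_add_bdiv (x - z) (2 ^ (k + 1))
  have h1 := Int.le_bmod (x := x - z) (m := 2 ^ (k + 1)) (by positivity)
  have h2 := Int.bmod_le (x := x - z) (m := 2 ^ (k + 1)) (by positivity)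
  push_cast at h h1 h2
  have hp : (2 : ℤ) ^ (k + 1) = 2 * 2 ^ k := pow_succ' _ _
  generalize (x - z).bdiv (2 ^ (k + 1)) = q at *
  generalize (2 : ℤ) ^ (k + 1) * q = s at *
  rw [abs_le]
  omega

/-- Two vertices at most `2 ^ tri t` apart are joined by a path of length at most
`(t + 1) * 2 ^ t`: for `t > 0`, go from both of them to nearby vertices of level exactly
`tri (t - 1)`, and join these by at most `2 ^ t` jumps of size `2 ^ (tri (t - 1) + 1)`. -/
theorem edist_le_of_abs_sub_le (t : ℕ) {x y : ℤ} (h : |y - x| ≤ 2 ^ tri t) :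
    modelGraph.edist x y ≤ ((t + 1) * 2 ^ t : ℕ) := by
  induction t generalizing x y with
  | zero =>
    have h1 : |y - x| = 1 ∨ x = y := by
      rw [tri_zero, pow_zero] at h
      rcases (abs_nonneg (y - x)).eq_or_lt with h0 | h0
      · right; linarith [abs_eq_zero.1 h0.symm]
      · left; omega
    simpa using SimpleGraph.edist_le_one_iff_adj_or_eq.2 (h1.imp_left Or.inl)
  | succ t ih =>
    obtain ⟨z, hz⟩ := exists_level_eq (tri t)
    have key : ∀ m : ℤ, level (z + 2 ^ (tri t + 1) * m) = tri t := level_add_mul hz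
    have jump : ∀ m n : ℤ, ∀ c : ℕ, |n - m| ≤ c →
        modelGraph.edist (z + 2 ^ (tri t + 1) * m) (z + 2 ^ (tri t + 1) * n) ≤ c := by
      have aux : ∀ m n : ℤ, ∀ c : ℕ, m ≤ n → |n - m| ≤ c →
        modelGraph.edist (z + 2 ^ (tri t + 1) * m) (z + 2 ^ (tri t + 1) * n) ≤ c := by
        intro m n c hmn hc
        have h1 := edist_add_mul_le (key m) (n - m).toNat
        rw [Int.toNat_of_nonneg (by omega)] at h1
        have e : z + 2 ^ (tri t + 1) * m + 2 ^ (tri t + 1) * (n - m)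
          = z + 2 ^ (tri t + 1) * n := by ring
        rw [e] at h1
        refine h1.trans (Nat.cast_le.2 ?_)
        rw [abs_of_nonneg (by omega)] at hc
        omega
      intro m n c hc
      rcases le_total m n with hmn | hmn
      · exact aux m n c hmn hc
      · rw [SimpleGraph.edist_comm]; exact aux n m c hmn (by rwa [abs_sub_comm])
    obtain ⟨m, hm⟩ := exists_near_residue (tri t) z x
    obtain ⟨n, hn⟩ := exists_near_residue (tri t) z y
    have hmn : |n - m| ≤ (2 ^ (t + 1) : ℕ) := by
      have hP : (0 : ℤ) < 2 ^ (tri t + 1) := by positivity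
      refine le_of_mul_le_mul_left ?_ hP
      have e1 : (2 : ℤ) ^ (tri t + 1) * |n - m| = |2 ^ (tri t + 1) * (n - m)| := by
        rw [abs_mul, abs_of_pos hP]
      have e2 : (2 : ℤ) ^ (tri t + 1) * (n - m) = (z + 2 ^ (tri t + 1) * n - y)
        - (z + 2 ^ (tri t + 1) * m - x) + (y - x) := by ring
      have h3 := abs_add_le ((z + 2 ^ (tri t + 1) * n - y) - (z + 2 ^ (tri t + 1) * m - x)) (y - x)
      have h4 := abs_sub (z + 2 ^ (tri t + 1) * n - y) (z + 2 ^ (tri t + 1) * m - x)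
      have hpow : (2 : ℤ) ^ tri (t + 1) = 2 ^ tri t * 2 ^ (t + 1) := by rw [tri_succ, pow_add]
      have h5 : (2 : ℤ) ≤ 2 ^ (t + 1) := by
        rw [pow_succ]; have : (1 : ℤ) ≤ 2 ^ t := one_le_pow₀ one_le_two
        omega
      have h6 : (2 : ℤ) ^ tri t * 2 ≤ 2 ^ tri t * 2 ^ (t + 1) := by gcongr
      have h7 : (2 : ℤ) ^ (tri t + 1) = 2 ^ tri t * 2 := pow_succ _ _
      rw [e1, e2, h7]
      push_cast
      rw [h7] at hm hn h3 h4
      nlinarith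
    have g1 := ih hm
    have g2 := ih (x := z + 2 ^ (tri t + 1) * n) (y := y) (by rwa [abs_sub_comm])
    refine (SimpleGraph.edist_triangle (v := z + 2 ^ (tri t + 1) * m)).trans ?_
    refine (add_le_add g1 ((SimpleGraph.edist_triangle
      (v := z + 2 ^ (tri t + 1) * n)).trans (add_le_add (jump m n _ hmn) g2))).trans ?_
    rw [← Nat.cast_add, ← Nat.cast_add, Nat.cast_le]
    rw [pow_succ]
    apply le_of_eq
    ring

/-! ### Infinite words as `2`-adic integers -/

/-- The integer with binary digits `w 0, ..., w (k - 1)`, least significant digit first: the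
residue modulo `2 ^ k` of the `2`-adic integer with digits `w`. -/
def prefixVal (w : ℕ → Fin 2) (k : ℕ) : ℤ := ∑ i ∈ Finset.range k, ((w i : ℕ) : ℤ) * 2 ^ i

theorem prefixVal_zero (w : ℕ → Fin 2) : prefixVal w 0 = 0 := rfl

theorem prefixVal_succ (w : ℕ → Fin 2) (k : ℕ) :
    prefixVal w (k + 1) = prefixVal w k + ((w k : ℕ) : ℤ) * 2 ^ k := Finset.sum_range_succ _ _

theorem digit_eq (x : Fin 2) : x = 0 ∧ (x : ℕ) = 0 ∨ x = 1 ∧ (x : ℕ) = 1 := by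
  fin_cases x <;> simp

theorem prefixVal_nonneg (w : ℕ → Fin 2) (k : ℕ) : 0 ≤ prefixVal w k :=
  Finset.sum_nonneg fun _ _ => by positivity

theorem prefixVal_lt (w : ℕ → Fin 2) (k : ℕ) : prefixVal w k < 2 ^ k := by
  induction k with
  | zero => simp [prefixVal_zero]
  | succ k ih =>
    have hp : (0 : ℤ) < 2 ^ k := by positivity
    rw [prefixVal_succ, pow_succ]
    rcases digit_eq (w k) with ⟨-, h⟩ | ⟨-, h⟩ <;> rw [h] <;> push_cast <;> linarith

theorem prefixVal_eq_of_dvd {w w' : ℕ → Fin 2} {k : ℕ}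
    (h : (2 : ℤ) ^ k ∣ prefixVal w k - prefixVal w' k) : prefixVal w k = prefixVal w' k := by
  have h1 := prefixVal_nonneg w k
  have h2 := prefixVal_lt w k
  have h3 := prefixVal_nonneg w' k
  have h4 := prefixVal_lt w' k
  exact sub_eq_zero.1 (Int.eq_zero_of_abs_lt_dvd h (abs_lt.2 ⟨by linarith, by linarith⟩))

theorem digit_eq_of_prefixVal {w w' : ℕ → Fin 2} {k : ℕ} {n : ℤ}
    (h : prefixVal w k = prefixVal w' k + n)
    (h' : prefixVal w (k + 1) = prefixVal w' (k + 1) + n) : w k = w' k := by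
  rw [prefixVal_succ, prefixVal_succ, h] at h'
  have h2 : ((w k : ℕ) : ℤ) * 2 ^ k = ((w' k : ℕ) : ℤ) * 2 ^ k := by linarith
  have h3 := mul_right_cancel₀ (by positivity) h2
  exact Fin.ext (by exact_mod_cast h3)

theorem eq_of_prefixVal_dvd {w w' : ℕ → Fin 2}
    (h : ∀ k, (2 : ℤ) ^ k ∣ prefixVal w k - prefixVal w' k) : w = w' := by
  funext k
  refine digit_eq_of_prefixVal (n := 0) ?_ ?_ <;> rw [add_zero] <;>
    exact prefixVal_eq_of_dvd (h _)

/-! ### The two generators in arithmetic terms -/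

theorem out_e (x : Fin 2) : automatonA.out .e x = x := rfl
theorem out_b (x : Fin 2) : automatonA.out .b x = x := rfl
theorem out_a_zero : automatonA.out .a 0 = 1 := rfl
theorem out_a_one : automatonA.out .a 1 = 0 := rfl
theorem next_e (x : Fin 2) : automatonA.next .e x = .e := rfl
theorem next_a_zero : automatonA.next .a 0 = .e := rfl
theorem next_a_one : automatonA.next .a 1 = .a := rfl
theorem next_b_zero : automatonA.next .b 0 = .b := rfl

/-- One step of an addition with carry: `D` is the number to be added, and the carry out of the
first `k` digits is pending exactly in the state `a`. -/
theorem prefixVal_carry_step {w : ℕ → Fin 2} {q : AState} {k : ℕ} {D : ℤ}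
    (h : automatonA.stateAt q w k = .a ∧
        prefixVal (automatonA.act q w) k + 2 ^ k = prefixVal w k + D ∨
      automatonA.stateAt q w k = .e ∧ prefixVal (automatonA.act q w) k = prefixVal w k + D) :
    automatonA.stateAt q w (k + 1) = .a ∧
        prefixVal (automatonA.act q w) (k + 1) + 2 ^ (k + 1) = prefixVal w (k + 1) + D ∨
      automatonA.stateAt q w (k + 1) = .e ∧
        prefixVal (automatonA.act q w) (k + 1) = prefixVal w (k + 1) + D := by
  rw [prefixVal_succ, prefixVal_succ, InvertibleMealy.stateAt, InvertibleMealy.act, pow_succ]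
  rcases h with ⟨hs, h⟩ | ⟨hs, h⟩ <;> rw [hs]
  · rcases digit_eq (w k) with ⟨h0, -⟩ | ⟨h0, -⟩ <;> rw [h0]
    · right
      refine ⟨next_a_zero, ?_⟩
      rw [out_a_zero]
      simp only [Fin.val_one, Fin.val_zero]
      push_cast
      linarith
    · left
      refine ⟨next_a_one, ?_⟩
      rw [out_a_one]
      simp only [Fin.val_one, Fin.val_zero]
      push_cast
      linarith
  · right
    exact ⟨next_e _, by rw [out_e]; linarith⟩

/-- The state `a` adds `1`. -/
theorem prefixVal_act_a (w : ℕ → Fin 2) (k : ℕ) :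
    automatonA.stateAt .a w k = .a ∧
        prefixVal (automatonA.act .a w) k + 2 ^ k = prefixVal w k + 1 ∨
      automatonA.stateAt .a w k = .e ∧
        prefixVal (automatonA.act .a w) k = prefixVal w k + 1 := by
  induction k with
  | zero => exact Or.inl ⟨rfl, rfl⟩
  | succ k ih => exact prefixVal_carry_step ih

/-- The state `b` adds `2 ^ (v + 1)`, where `v` is the position of the first digit `1`. -/
theorem prefixVal_act_b (w : ℕ → Fin 2) (k : ℕ) :
    (automatonA.stateAt .b w k = .b ∧ prefixVal (automatonA.act .b w) k = 0 ∧ prefixVal w k = 0) ∨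
    ∃ v < k, prefixVal w v = 0 ∧ prefixVal w (v + 1) ≠ 0 ∧
      (automatonA.stateAt .b w k = .a ∧
        prefixVal (automatonA.act .b w) k + 2 ^ k = prefixVal w k + 2 ^ (v + 1) ∨
      automatonA.stateAt .b w k = .e ∧
        prefixVal (automatonA.act .b w) k = prefixVal w k + 2 ^ (v + 1)) := by
  induction k with
  | zero => exact Or.inl ⟨rfl, rfl, rfl⟩
  | succ k ih =>
    rcases ih with ⟨hs, h1, h2⟩ | ⟨v, hv, h1, h2, h3⟩
    · rcases digit_eq (w k) with ⟨h0, -⟩ | ⟨h0, -⟩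
      · left
        rw [prefixVal_succ, prefixVal_succ, InvertibleMealy.stateAt, InvertibleMealy.act, hs, h0,
          h1, h2]
        exact ⟨next_b_zero, by simp [out_b], by simp⟩
      · right
        refine ⟨k, k.lt_succ_self, h2, ?_, Or.inl ⟨?_, ?_⟩⟩
        · rw [prefixVal_succ, h0, h2]; simp
        · rw [InvertibleMealy.stateAt, hs, h0]; rfl
        · rw [prefixVal_succ, prefixVal_succ, InvertibleMealy.act, hs, h0, h1, h2, out_b]
    · exact Or.inr ⟨v, by omega, h1, h2, prefixVal_carry_step h3⟩

theorem pow_dvd_prefixVal_act_a (w : ℕ → Fin 2) (k : ℕ) :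
    (2 : ℤ) ^ k ∣ prefixVal (automatonA.act .a w) k - (prefixVal w k + 1) := by
  rcases prefixVal_act_a w k with ⟨-, h⟩ | ⟨-, h⟩
  · exact ⟨-1, by linarith⟩
  · exact ⟨0, by linarith⟩

/-! ### The orbit of `(01)^∞` is a copy of the integers -/

theorem three_mul_prefixVal_word01 (k : ℕ) :
    3 * prefixVal word01 k = (1 + ((k + 1) % 2 : ℕ)) * 2 ^ k - 2 := by
  induction k with
  | zero => simp [prefixVal_zero]
  | succ k ih =>
    rw [prefixVal_succ, mul_add, ih, word01, pow_succ]
    rcases Nat.mod_two_eq_zero_or_one k with h | h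
    · have e1 : (k + 1) % 2 = 1 := by omega
      have e2 : (k + 1 + 1) % 2 = 0 := by omega
      rw [e1, e2, if_pos h]
      push_cast
      simp only [Fin.val_zero]
      push_cast
      ring
    · have e1 : (k + 1) % 2 = 0 := by omega
      have e2 : (k + 1 + 1) % 2 = 1 := by omega
      rw [e1, e2, if_neg (by omega)]
      simp only [Fin.val_one]
      push_cast
      ring

/-- The word obtained from `(01)^∞` by adding the integer `n`. As `(01)^∞` is the binary expansion
of `-2 / 3`, this is the expansion of `n - 2 / 3`. -/
def point (n : ℤ) : ℕ → Fin 2 := (automatonA.perm .a ^ n) word01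

theorem perm_a_point (n : ℤ) : automatonA.perm .a (point n) = point (n + 1) := by
  rw [point, point, add_comm, zpow_one_add]; rfl

theorem point_zero : point 0 = word01 := rfl

theorem pow_dvd_prefixVal_point (n : ℤ) (k : ℕ) :
    (2 : ℤ) ^ k ∣ prefixVal (point n) k - (prefixVal word01 k + n) := by
  have step : ∀ m : ℤ, (2 : ℤ) ^ k ∣ prefixVal (point (m + 1)) k - (prefixVal (point m) k + 1) := by
    intro m
    rw [← perm_a_point]
    exact pow_dvd_prefixVal_act_a _ _
  induction n using Int.induction_on with
  | zero => simp [point_zero]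
  | succ i ih => exact (dvd_add ih (step i)).trans (dvd_of_eq (by ring))
  | pred i ih =>
    have := step (-i - 1)
    rw [sub_add_cancel] at this
    exact (dvd_sub ih this).trans (dvd_of_eq (by ring))

theorem pow_dvd_three_mul_prefixVal_point (n : ℤ) (k : ℕ) :
    (2 : ℤ) ^ k ∣ 3 * prefixVal (point n) k - (3 * n - 2) := by
  have h1 := (pow_dvd_prefixVal_point n k).mul_left 3
  have h2 : (2 : ℤ) ^ k ∣ 3 * prefixVal word01 k + 2 :=
    ⟨1 + ((k + 1) % 2 : ℕ), by rw [three_mul_prefixVal_word01]; ring⟩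
  exact (dvd_add h1 h2).trans (dvd_of_eq (by ring))

/-- The level of `n` is the number of leading zeros of `point n`. -/
theorem prefixVal_point_eq_zero_iff {n : ℤ} {k : ℕ} :
    prefixVal (point n) k = 0 ↔ k ≤ level n := by
  have h := pow_dvd_three_mul_prefixVal_point n k
  rw [← pow_dvd_iff_le_level]
  constructor
  · intro h0
    rwa [h0, mul_zero, zero_sub, dvd_neg] at h
  · intro h0
    have h1 := dvd_add h h0
    rw [sub_add_cancel] at h1
    have h2 := (IsCoprime.pow_left ⟨-1, 1, by norm_num⟩ :
      IsCoprime ((2 : ℤ) ^ k) 3).dvd_of_dvd_mul_left h1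
    refine Int.eq_zero_of_abs_lt_dvd h2 ?_
    rw [abs_of_nonneg (prefixVal_nonneg _ _)]
    exact prefixVal_lt _ _

theorem perm_b_point (n : ℤ) :
    automatonA.perm .b (point n) = point (n + 2 ^ (level n + 1)) := by
  have hl : level (n + 2 ^ (level n + 1)) = level n := by
    simpa using level_add_mul (n := n) rfl 1
  refine eq_of_prefixVal_dvd fun k => ?_
  change (2 : ℤ) ^ k ∣ prefixVal (automatonA.act .b (point n)) k - _
  rcases prefixVal_act_b (point n) k with ⟨-, h1, h2⟩ | ⟨v, hv, h1, h2, h3⟩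
  · rw [prefixVal_point_eq_zero_iff, ← hl, ← prefixVal_point_eq_zero_iff] at h2
    rw [h1, h2, sub_zero]
    exact dvd_zero _
  · rw [Ne, prefixVal_point_eq_zero_iff] at h2
    rw [prefixVal_point_eq_zero_iff] at h1
    have hlv : v = level n := by omega
    have h4 : (2 : ℤ) ^ k ∣ prefixVal (automatonA.act .b (point n)) k
        - (prefixVal (point n) k + 2 ^ (level n + 1)) := by
      rw [← hlv]
      rcases h3 with ⟨-, h⟩ | ⟨-, h⟩
      · exact ⟨-1, by linarith⟩
      · exact ⟨0, by linarith⟩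
    have h5 := pow_dvd_prefixVal_point n k
    have h6 := pow_dvd_prefixVal_point (n + 2 ^ (level n + 1)) k
    exact (dvd_sub (dvd_add h4 h5) h6).trans (dvd_of_eq (by ring))

theorem point_injective : Function.Injective point := by
  intro m n h
  have h1 : ∀ k, (2 : ℤ) ^ k ∣ m - n := by
    intro k
    have h2 := pow_dvd_prefixVal_point m k
    rw [h] at h2
    exact (dvd_sub (pow_dvd_prefixVal_point n k) h2).trans (dvd_of_eq (by ring))
  have h3 := Int.eq_zero_of_abs_lt_dvd (h1 (m - n).natAbs) (by
    rw [Int.abs_eq_natAbs]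
    exact_mod_cast Nat.lt_two_pow_self)
  omega

theorem point_mem_orbit (n : ℤ) : point n ∈ MulAction.orbit groupG word01 := by
  refine ⟨genA ^ n, ?_⟩
  change ((genA ^ n : groupG) : Equiv.Perm (ℕ → Fin 2)) word01 = _
  rw [Subgroup.coe_zpow]; rfl

theorem mem_range_point_of_mem_orbit {w : ℕ → Fin 2} (hw : w ∈ MulAction.orbit groupG word01) :
    w ∈ Set.range point := by
  obtain ⟨⟨g, hg⟩, rfl⟩ := hw
  change g word01 ∈ Set.range point
  suffices H : ∀ w, w ∈ Set.range point ↔ g w ∈ Set.range point from (H _).1 ⟨0, rfl⟩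
  have hg' : g ∈ Subgroup.closure {automatonA.perm .a, automatonA.perm .b} := hg
  clear hg
  induction hg' using Subgroup.closure_induction with
  | mem g hg =>
    intro w
    rcases hg with rfl | rfl
    · constructor
      · rintro ⟨n, rfl⟩
        exact ⟨n + 1, (perm_a_point n).symm⟩
      · rintro ⟨n, hn⟩
        refine ⟨n - 1, (automatonA.perm .a).injective ?_⟩
        rw [perm_a_point, sub_add_cancel, hn]
    · constructor
      · rintro ⟨n, rfl⟩
        exact ⟨_, (perm_b_point n).symm⟩
      · rintro ⟨n, hn⟩
        refine ⟨n - 2 ^ (level n + 1), (automatonA.perm .b).injective ?_⟩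
        have hl : level (n - 2 ^ (level n + 1)) = level n := by
          simpa [← sub_eq_add_neg] using level_add_mul (n := n) rfl (-1)
        rw [perm_b_point, hl, sub_add_cancel, hn]
  | one => exact fun w => Iff.rfl
  | mul g h _ _ ihg ihh => exact fun w => (ihh w).trans (ihg _)
  | inv g _ ih =>
    intro w
    rw [ih (g⁻¹ w), ← Equiv.Perm.mul_apply, mul_inv_cancel, Equiv.Perm.one_apply]

/-- The integers parametrize the orbit of `(01)^∞`. -/
noncomputable def orbitEquiv : ℤ ≃ MulAction.orbit groupG word01 :=
  Equiv.ofBijective (fun n => ⟨point n, point_mem_orbit n⟩)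
    ⟨fun _ _ h => point_injective (congrArg Subtype.val h), fun ⟨_, hw⟩ =>
      let ⟨n, hn⟩ := mem_range_point_of_mem_orbit hw
      ⟨n, Subtype.ext hn⟩⟩

theorem genA_smul_orbitEquiv (n : ℤ) : genA • orbitEquiv n = orbitEquiv (n + 1) :=
  Subtype.ext (perm_a_point n)

theorem genB_smul_orbitEquiv (n : ℤ) :
    genB • orbitEquiv n = orbitEquiv (n + 2 ^ (level n + 1)) :=
  Subtype.ext (perm_b_point n)

theorem genA_ne_genB : genA ≠ genB := by
  intro h
  have h1 := genA_smul_orbitEquiv 0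
  rw [h, genB_smul_orbitEquiv, orbitEquiv.injective.eq_iff, add_right_inj, pow_succ] at h1
  omega

/-! ### The orbital graph and the model graph -/

theorem exists_edge_iff {m n : ℤ} :
    (∃ s, (orbitalGraph word01).Edge s (orbitEquiv m) (orbitEquiv n)) ↔
      n = m + 1 ∨ n = m + 2 ^ (level m + 1) := by
  constructor
  · rintro ⟨⟨s, rfl | rfl⟩, hs⟩
    · left
      have : genA • orbitEquiv m = orbitEquiv n := hs
      rw [genA_smul_orbitEquiv] at this
      exact (orbitEquiv.injective this).symm
    · right
      have : genB • orbitEquiv m = orbitEquiv n := hs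
      rw [genB_smul_orbitEquiv] at this
      exact (orbitEquiv.injective this).symm
  · rintro (rfl | rfl)
    · exact ⟨⟨genA, Or.inl rfl⟩, genA_smul_orbitEquiv m⟩
    · exact ⟨⟨genB, Or.inr rfl⟩, genB_smul_orbitEquiv m⟩

/-- The model graph is the orbital graph without labels and orientation. -/
noncomputable def modelIso : modelGraph ≃g (orbitalGraph word01).toSimpleGraph where
  toEquiv := orbitEquiv
  map_rel_iff' := by
    intro m n
    rw [LabeledGraph.toSimpleGraph, SimpleGraph.fromRel_adj, exists_edge_iff, exists_edge_iff,
      orbitEquiv.injective.ne_iff]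
    constructor
    · rintro ⟨-, (h | h) | (h | h)⟩
      · left; rw [h, add_sub_cancel_left, abs_one]
      · right; rw [h, add_sub_cancel_left, abs_of_pos (by positivity)]
      · left; rw [h, sub_add_cancel_left, abs_neg, abs_one]
      · refine SimpleGraph.Adj.symm (G := modelGraph) (Or.inr ?_)
        rw [h, add_sub_cancel_left, abs_of_pos (by positivity)]
    · intro h
      refine ⟨h.ne, ?_⟩
      rcases h with h | h
      · rcases abs_eq (by norm_num) |>.1 h with h | h
        · exact Or.inl (Or.inl (by omega))
        · exact Or.inr (Or.inl (by omega))
      · have hl := level_eq_of_abs_sub h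
        rcases abs_eq (by positivity) |>.1 h with h | h
        · exact Or.inl (Or.inr (by linarith))
        · exact Or.inr (Or.inr (by rw [hl]; linarith))

theorem modelIso_apply (n : ℤ) : modelIso n = orbitEquiv n := rfl

theorem edist_map_le {V W : Type*} {G : SimpleGraph V} {H : SimpleGraph W} (f : G →g H) (u v : V) :
    H.edist (f u) (f v) ≤ G.edist u v := by
  rcases eq_or_ne (G.edist u v) ⊤ with h | h
  · rw [h]; exact le_top
  · obtain ⟨p, hp⟩ := SimpleGraph.exists_walk_of_edist_ne_top h
    rw [← hp, ← SimpleGraph.Walk.length_map f p]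
    exact SimpleGraph.edist_le _

theorem edist_orbitEquiv (m n : ℤ) :
    (orbitalGraph word01).toSimpleGraph.edist (orbitEquiv m) (orbitEquiv n)
      = modelGraph.edist m n := by
  refine le_antisymm (edist_map_le modelIso.toHom m n) ?_
  simpa [← modelIso_apply] using edist_map_le modelIso.symm.toHom (modelIso m) (modelIso n)

theorem growth_orbitEquiv (m : ℤ) (n : ℕ) :
    (orbitalGraph word01).growth (orbitEquiv m) n = {y | modelGraph.edist m y ≤ n}.ncard := by
  rw [LabeledGraph.growth, ← Set.ncard_image_of_injective _ orbitEquiv.injective]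
  congr 1
  ext y
  obtain ⟨k, rfl⟩ := orbitEquiv.surjective y
  rw [orbitEquiv.injective.mem_set_image, LabeledGraph.ball, Set.mem_ofPred_eq, edist_orbitEquiv,
    Set.mem_ofPred_eq]

theorem degree_orbitalGraph (x : MulAction.orbit groupG word01) :
    (orbitalGraph word01).degree x = 4 := by
  have hS : (Set.univ : Set ({genA, genB} : Set groupG)).encard = 2 := by
    rw [Set.encard_univ, ENat.card_coe_set_eq, Set.encard_pair genA_ne_genB]
  have h1 : {p : ({genA, genB} : Set groupG) × MulAction.orbit groupG word01 |
      (orbitalGraph word01).Edge p.1 x p.2} =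
      (fun s : ({genA, genB} : Set groupG) => (s, (s : groupG) • x)) '' Set.univ := by
    ext ⟨s, y⟩
    constructor
    · intro h
      exact ⟨s, trivial, Prod.ext rfl h⟩
    · rintro ⟨s', -, h⟩
      obtain ⟨rfl, rfl⟩ := Prod.mk.inj h
      rfl
  have h2 : {p : ({genA, genB} : Set groupG) × MulAction.orbit groupG word01 |
      (orbitalGraph word01).Edge p.1 p.2 x} =
      (fun s : ({genA, genB} : Set groupG) => (s, (s : groupG)⁻¹ • x)) '' Set.univ := by
    ext ⟨s, y⟩
    constructor
    · intro h
      exact ⟨s, trivial, Prod.ext rfl (inv_smul_eq_iff.2 (Eq.symm h))⟩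
    · rintro ⟨s', -, h⟩
      obtain ⟨rfl, rfl⟩ := Prod.mk.inj h
      exact smul_inv_smul _ _
  rw [LabeledGraph.degree, h1, h2,
    Function.Injective.encard_image (fun s t h => congrArg Prod.fst h),
    Function.Injective.encard_image (fun s t h => congrArg Prod.fst h), hS]
  rfl

theorem encard_neighborSet_orbitalGraph (x : MulAction.orbit groupG word01) :
    ((orbitalGraph word01).toSimpleGraph.neighborSet x).encard = 4 := by
  obtain ⟨m, rfl⟩ := orbitEquiv.surjective x
  have hp : (2 : ℤ) ≤ 2 ^ (level m + 1) := by
    rw [pow_succ]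
    have : (1 : ℤ) ≤ 2 ^ level m := one_le_pow₀ one_le_two
    omega
  have h : (orbitalGraph word01).toSimpleGraph.neighborSet (orbitEquiv m) = orbitEquiv ''
      {m + 1, m - 1, m + 2 ^ (level m + 1), m - 2 ^ (level m + 1)} := by
    ext y
    obtain ⟨n, rfl⟩ := orbitEquiv.surjective y
    rw [orbitEquiv.injective.mem_set_image, SimpleGraph.mem_neighborSet]
    refine (modelIso.map_adj_iff (v := m) (w := n)).trans ?_
    rw [modelGraph_adj, abs_eq (by norm_num), abs_eq (by positivity)]
    simp only [Set.mem_insert_iff, Set.mem_singleton_iff]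
    omega
  rw [h, orbitEquiv.injective.encard_image]
  generalize (2 : ℤ) ^ (level m + 1) = P at hp
  rw [Set.encard_insert_of_notMem, Set.encard_insert_of_notMem, Set.encard_pair]
  · rfl
  · omega
  all_goals simp only [Set.mem_insert_iff, Set.mem_singleton_iff]; omega

/-! ### Growth estimates -/

theorem le_tri (t : ℕ) : t ≤ tri t := by
  cases t with
  | zero => exact le_rfl
  | succ t => rw [tri_succ]; omega

theorem four_mul_abs_le_two_pow_tri {t : ℕ} {x : ℤ} (ht : (4 * (3 * x - 2)).natAbs ≤ t) :
    4 * |3 * x - 2| ≤ 2 ^ tri (t + 1) := by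
  have h1 : (4 * (3 * x - 2)).natAbs ≤ 2 ^ tri (t + 1) :=
    ht.trans ((by have := le_tri (t + 1); omega : t ≤ tri (t + 1)).trans Nat.lt_two_pow_self.le)
  have h2 : ((4 * (3 * x - 2)).natAbs : ℤ) ≤ 2 ^ tri (t + 1) := by exact_mod_cast h1
  rwa [Int.natCast_natAbs, abs_mul, abs_of_pos (by norm_num : (0 : ℤ) < 4)] at h2

theorem setOf_edist_le_subset {t n : ℕ} (ht : 1 ≤ t) {x : ℤ}
    (hx : (4 * (3 * x - 2)).natAbs ≤ t) (hn : 4 * n < 2 ^ t) :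
    {y | modelGraph.edist x y ≤ n} ⊆
      Set.Icc (x - n * 2 ^ tri (t + 1)) (x + n * 2 ^ tri (t + 1)) := by
  intro y hy
  have h := abs_le.1 (abs_sub_le_of_edist_le ht (four_mul_abs_le_two_pow_tri hx) hn hy)
  exact ⟨by linarith [h.1], by linarith [h.2]⟩

theorem finite_setOf_edist_le (x : ℤ) (n : ℕ) : {y | modelGraph.edist x y ≤ n}.Finite := by
  refine (Set.finite_Icc _ _).subset
    (setOf_edist_le_subset (t := 4 * n + (4 * (3 * x - 2)).natAbs + 1) ?_ ?_ ?_)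
  · omega
  · omega
  · exact (by omega : 4 * n < 4 * n + (4 * (3 * x - 2)).natAbs + 1).trans Nat.lt_two_pow_self

theorem ncard_setOf_edist_le_mono (x : ℤ) {m n : ℕ} (h : m ≤ n) :
    {y | modelGraph.edist x y ≤ m}.ncard ≤ {y | modelGraph.edist x y ≤ n}.ncard :=
  Set.ncard_le_ncard (fun _ hy => le_trans (b := (m : ℕ∞)) hy (by exact_mod_cast h))
    (finite_setOf_edist_le x n)

theorem ncard_setOf_edist_le_le {x : ℤ} {n : ℕ}
    (hx : (4 * (3 * x - 2)).natAbs ≤ Nat.log 2 n) :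
    {y | modelGraph.edist x y ≤ n}.ncard ≤ 2 ^ 28 * 2 ^ (Nat.log 2 n) ^ 2 := by
  have hlt : n < 2 ^ (Nat.log 2 n + 1) := Nat.lt_pow_succ_log_self one_lt_two n
  generalize hl : Nat.log 2 n = l at *
  have hsub := setOf_edist_le_subset (t := l + 3) (x := x) (n := n) (by omega) (by omega)
    (by rw [pow_add] at *; omega)
  have h1 := Set.ncard_le_ncard hsub (Set.finite_Icc _ _)
  have e : (Set.Icc (x - n * 2 ^ tri (l + 3 + 1)) (x + n * 2 ^ tri (l + 3 + 1))).ncard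
      = 2 * (n * 2 ^ tri (l + 4)) + 1 := by
    rw [← Finset.coe_Icc, Set.ncard_coe_finset, Int.card_Icc]
    have : ((n * 2 ^ tri (l + 4) : ℕ) : ℤ) = n * 2 ^ tri (l + 3 + 1) := by push_cast; rfl
    omega
  rw [e] at h1
  have h2 : (n + 1) * 2 ^ tri (l + 4) ≤ 2 ^ (l + 1) * 2 ^ tri (l + 4) := by gcongr; exact hlt
  have h3 : 2 * (n * 2 ^ tri (l + 4)) + 1 ≤ 2 ^ (l + 2 + tri (l + 4)) := by
    have e3 : 2 ^ (l + 2 + tri (l + 4)) = 2 * (2 ^ (l + 1) * 2 ^ tri (l + 4)) := by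
      rw [← pow_add, ← pow_succ']; congr 1; omega
    have : 1 ≤ 2 ^ tri (l + 4) := Nat.one_le_two_pow
    rw [e3]
    rw [add_mul, one_mul] at h2
    omega
  refine h1.trans (h3.trans ?_)
  rw [← pow_add]
  refine Nat.pow_le_pow_right two_pos ?_
  have h4 := two_mul_tri (l + 4)
  -- `2 * (l ^ 2 + 28) - (l ^ 2 + 11 * l + 24) = l ^ 2 - 11 * l + 32` has negative discriminant
  zify at h4 ⊢
  nlinarith [sq_nonneg (2 * (l : ℤ) - 11)]

theorem two_pow_sq_log_le {n : ℕ} (hn : n ≠ 0) :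
    (2 : ℝ) ^ (Nat.log 2 n) ^ 2 ≤ (n : ℝ) ^ Real.logb 2 n := by
  have h1 : (1 : ℝ) ≤ n := by exact_mod_cast Nat.one_le_iff_ne_zero.2 hn
  have h2 : (2 : ℝ) ^ Nat.log 2 n ≤ n := by exact_mod_cast Nat.pow_log_le_self 2 hn
  calc (2 : ℝ) ^ (Nat.log 2 n) ^ 2 = (2 ^ Nat.log 2 n) ^ Nat.log 2 n := by rw [sq, pow_mul]
    _ ≤ (n : ℝ) ^ Nat.log 2 n := by gcongr
    _ = (n : ℝ) ^ (Nat.log 2 n : ℝ) := (Real.rpow_natCast _ _).symm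
    _ ≤ (n : ℝ) ^ Real.logb 2 n :=
      Real.rpow_le_rpow_of_exponent_le h1 (Real.natLog_le_logb n 2)

theorem growth_le (x : MulAction.orbit groupG word01) :
    ∃ C : ℝ, 0 < C ∧ ∀ n : ℕ, 1 ≤ n →
      ((orbitalGraph word01).growth x n : ℝ) ≤ C * (n : ℝ) ^ Real.logb 2 n := by
  obtain ⟨x, rfl⟩ := orbitEquiv.surjective x
  set N := 2 ^ (4 * (3 * x - 2)).natAbs with hN
  refine ⟨2 ^ 28 + (orbitalGraph word01).growth (orbitEquiv x) N, by positivity, fun n hn => ?_⟩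
  have hn0 : n ≠ 0 := by omega
  have hpow := two_pow_sq_log_le hn0
  have hone : (1 : ℝ) ≤ 2 ^ (Nat.log 2 n) ^ 2 := one_le_pow₀ one_le_two
  rw [growth_orbitEquiv, growth_orbitEquiv, add_mul]
  rcases le_total N n with h | h
  · have h1 := ncard_setOf_edist_le_le (x := x) (Nat.le_log_of_pow_le one_lt_two h)
    have h2 : ({y | modelGraph.edist x y ≤ n}.ncard : ℝ) ≤ 2 ^ 28 * 2 ^ (Nat.log 2 n) ^ 2 := by
      exact_mod_cast h1
    refine h2.trans (le_add_of_le_of_nonneg (by gcongr) (by positivity))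
  · have h1 : ({y | modelGraph.edist x y ≤ n}.ncard : ℝ) ≤
        ({y | modelGraph.edist x y ≤ N}.ncard : ℝ) := by
      exact_mod_cast ncard_setOf_edist_le_mono x h
    refine le_add_of_nonneg_of_le (by positivity) (h1.trans ?_)
    exact le_mul_of_one_le_right (by positivity) (hone.trans hpow)

theorem two_pow_tri_le_growth {t n : ℕ} (h : (t + 1) * 2 ^ t ≤ n)
    (x : MulAction.orbit groupG word01) : 2 ^ tri t ≤ (orbitalGraph word01).growth x n := by
  obtain ⟨x, rfl⟩ := orbitEquiv.surjective x
  rw [growth_orbitEquiv]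
  have hsub : Set.Icc x (x + 2 ^ tri t) ⊆ {y | modelGraph.edist x y ≤ n} := by
    intro y hy
    refine (edist_le_of_abs_sub_le t ?_).trans (Nat.cast_le.2 h)
    rw [abs_of_nonneg (by linarith [hy.1])]
    linarith [hy.2]
  have h1 := Set.ncard_le_ncard hsub (finite_setOf_edist_le x n)
  rw [← Finset.coe_Icc, Set.ncard_coe_finset, Int.card_Icc] at h1
  have : ((2 ^ tri t : ℕ) : ℤ) = 2 ^ tri t := by push_cast; rfl
  omega

theorem eventually_add_one_le_two_rpow {ε : ℝ} (hε : 0 < ε) :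
    ∀ᶠ L : ℝ in atTop, L + 1 ≤ (2 : ℝ) ^ (ε * L) := by
  have hb : 0 < Real.log 2 * ε := mul_pos (Real.log_pos one_lt_two) hε
  have h := (isLittleO_pow_exp_pos_mul_atTop 1 hb).bound (by norm_num : (0 : ℝ) < 1 / 2)
  filter_upwards [h, eventually_ge_atTop 1] with L h1 h2
  rw [pow_one, Real.norm_of_nonneg (by linarith), Real.norm_of_nonneg (Real.exp_pos _).le] at h1
  rw [Real.rpow_def_of_pos two_pos, ← mul_assoc]
  linarith

theorem tendsto_logb_natCast_atTop : Tendsto (fun n : ℕ => Real.logb 2 n) atTop atTop :=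
  (Real.tendsto_logb_atTop one_lt_two).comp tendsto_natCast_atTop_atTop

/-- With `L = log₂ n`, apply `two_pow_tri_le_growth` to `t = ⌊(1 - ε) * L⌋`. -/
theorem eventually_le_growth_of_lt_one (x : MulAction.orbit groupG word01) {ε : ℝ} (hε : 0 < ε)
    (hε1 : ε < 1) : ∀ᶠ n : ℕ in atTop,
      (n : ℝ) ^ ((1 / 2 - ε) * Real.logb 2 n) ≤ ((orbitalGraph word01).growth x n : ℝ) := by
  filter_upwards [tendsto_logb_natCast_atTop.eventually (eventually_add_one_le_two_rpow hε),
    tendsto_logb_natCast_atTop.eventually (eventually_ge_atTop ((1 - ε) / ε ^ 2)),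
    tendsto_logb_natCast_atTop.eventually (eventually_ge_atTop 0), eventually_gt_atTop 0]
    with n h1 h2 h0 hn
  have hn' : (0 : ℝ) < n := by exact_mod_cast hn
  have hnL : (2 : ℝ) ^ Real.logb 2 n = n := Real.rpow_logb two_pos (by norm_num) hn'
  set L := Real.logb 2 n
  set u := (1 - ε) * L with hu
  have hu0 : 0 ≤ u := mul_nonneg (by linarith) h0
  have hfl := Nat.floor_le hu0
  have hlt := (Nat.lt_floor_add_one u).le
  set t := ⌊u⌋₊
  have hbound : ((t + 1) * 2 ^ t : ℝ) ≤ n := by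
    calc ((t + 1) * 2 ^ t : ℝ) = (t + 1) * (2 : ℝ) ^ (t : ℝ) := by rw [Real.rpow_natCast]
      _ ≤ (L + 1) * (2 : ℝ) ^ u := by
        refine mul_le_mul ?_ ?_ (by positivity) (by positivity)
        · have : u ≤ L := by rw [hu]; nlinarith
          linarith
        · exact Real.rpow_le_rpow_of_exponent_le one_le_two hfl
      _ ≤ 2 ^ (ε * L) * 2 ^ u := by gcongr
      _ = n := by
        rw [← Real.rpow_add two_pos, hu, ← add_mul, add_sub_cancel, one_mul, hnL]
  have hgrowth : ((2 ^ tri t : ℕ) : ℝ) ≤ (orbitalGraph word01).growth x n :=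
    Nat.cast_le.2 (two_pow_tri_le_growth (by exact_mod_cast hbound) x)
  refine le_trans ?_ hgrowth
  rw [← hnL, ← Real.rpow_mul two_pos.le, Nat.cast_pow, Nat.cast_two, ← Real.rpow_natCast]
  refine Real.rpow_le_rpow_of_exponent_le one_le_two ?_
  have htri : 2 * (tri t : ℝ) = t * (t + 1) := by exact_mod_cast two_mul_tri t
  have h3 : 1 - ε ≤ ε ^ 2 * L := by
    rw [div_le_iff₀ (by positivity)] at h2; linarith
  have h4 : (1 - ε) * L ≤ ε ^ 2 * L * L := mul_le_mul_of_nonneg_right h3 h0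
  have h5 : (u - 1) * u ≤ t * (t + 1) := by
    rcases le_total 1 u with h | h
    · exact mul_le_mul (by linarith) hlt hu0 (by positivity)
    · exact (mul_nonpos_of_nonpos_of_nonneg (by linarith) hu0).trans (by positivity)
  have h6 : (u - 1) * u = (1 - 2 * ε) * L * L + (ε ^ 2 * L * L - (1 - ε) * L) := by rw [hu]; ring
  linarith

theorem eventually_le_growth (x : MulAction.orbit groupG word01) {ε : ℝ} (hε : 0 < ε) :
    ∀ᶠ n : ℕ in atTop,
      (n : ℝ) ^ ((1 / 2 - ε) * Real.logb 2 n) ≤ ((orbitalGraph word01).growth x n : ℝ) := by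
  have h1 : min ε (1 / 2) < 1 := (min_le_right _ _).trans_lt (by norm_num)
  filter_upwards [eventually_le_growth_of_lt_one x (lt_min hε (by norm_num)) h1,
    tendsto_logb_natCast_atTop.eventually (eventually_ge_atTop 0), eventually_ge_atTop 1]
    with n h2 h0 hn
  refine le_trans (Real.rpow_le_rpow_of_exponent_le (by exact_mod_cast hn) ?_) h2
  gcongr
  exact min_le_left _ _

theorem isLittleO_rpow_logb_pow {c : ℝ} (hc : 1 < c) :
    (fun n : ℕ => (n : ℝ) ^ Real.logb 2 n) =o[atTop] fun n : ℕ => c ^ n := by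
  have hlc : 0 < Real.log c := Real.log_pos hc
  have hl2 : 0 < Real.log 2 := Real.log_pos one_lt_two
  have hmain : (fun n : ℕ => Real.exp (Real.log n ^ 2 / Real.log 2)) =o[atTop]
      fun n : ℕ => Real.exp (n * Real.log c) := by
    rw [Real.isLittleO_exp_comp_exp_comp]
    have h1 := (Real.isLittleO_pow_log_id_atTop (n := 2)).comp_tendsto tendsto_natCast_atTop_atTop
      |>.bound (show 0 < Real.log 2 * Real.log c / 2 by positivity)
    have h2 : Tendsto (fun n : ℕ => (n : ℝ) * (Real.log c / 2)) atTop atTop :=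
      tendsto_natCast_atTop_atTop.atTop_mul_const (by positivity)
    refine tendsto_atTop_mono' _ ?_ h2
    filter_upwards [h1] with n hn
    simp only [Function.comp_apply, id, norm_pow, Real.norm_eq_abs, sq_abs, Nat.abs_cast] at hn
    have : Real.log n ^ 2 / Real.log 2 ≤ n * (Real.log c / 2) := by
      rw [div_le_iff₀ hl2]; linarith
    linarith
  refine hmain.congr' ?_ ?_
  · filter_upwards [eventually_gt_atTop 0] with n hn
    rw [Real.rpow_def_of_pos (by exact_mod_cast hn), Real.logb]
    congr 1; ring
  · filter_upwards with n
    rw [mul_comm, Real.exp_mul, Real.exp_log (by linarith), Real.rpow_natCast]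

theorem isIntermediateGrowth_growth (x : MulAction.orbit groupG word01) :
    IsIntermediateGrowth ((orbitalGraph word01).growth x) := by
  constructor
  · intro d
    have h1 : (fun n : ℕ => (n : ℝ) ^ d) =o[atTop] fun n : ℕ => (n : ℝ) ^ (d + 1) :=
      (isLittleO_pow_pow_atTop_of_lt d.lt_succ_self).comp_tendsto tendsto_natCast_atTop_atTop
    refine h1.trans_isBigO (IsBigO.of_bound 1 ?_)
    filter_upwards [eventually_le_growth x (by norm_num : (0 : ℝ) < 1 / 4),
      tendsto_logb_natCast_atTop.eventually (eventually_ge_atTop (4 * (d + 1 : ℝ))),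
      eventually_ge_atTop 1] with n h2 h3 hn
    rw [one_mul, Real.norm_of_nonneg (by positivity), Real.norm_of_nonneg (by positivity)]
    refine le_trans ?_ h2
    rw [← Real.rpow_natCast]
    refine Real.rpow_le_rpow_of_exponent_le (by exact_mod_cast hn) ?_
    push_cast
    linarith
  · intro c hc
    obtain ⟨C, -, h⟩ := growth_le x
    refine IsBigO.trans_isLittleO (IsBigO.of_bound C ?_) (isLittleO_rpow_logb_pow hc)
    filter_upwards [eventually_ge_atTop 1] with n hn
    rw [Real.norm_of_nonneg (by positivity), Real.norm_of_nonneg (by positivity)]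
    exact h n hn

/-! ### Codes of the vertices -/

theorem word01_succ (n : ℕ) : word01 (n + 1) = 1 - word01 n := by
  rw [word01, word01]
  rcases Nat.mod_two_eq_zero_or_one n with h | h
  · rw [if_neg (by omega), if_pos h]; rfl
  · rw [if_pos (by omega), if_neg (by omega)]; rfl

theorem prefixVal_sub_eq_of_eq {w : ℕ → Fin 2} {N : ℕ} (h : ∀ i, N ≤ i → w i = word01 i) {k : ℕ}
    (hk : N ≤ k) : prefixVal w k = prefixVal word01 k + (prefixVal w N - prefixVal word01 N) := by
  induction k, hk using Nat.le_induction with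
  | base => ring
  | succ k hk ih => rw [prefixVal_succ, prefixVal_succ, ih, h k hk]; ring

theorem mem_orbit_of_eventually_eq {w : ℕ → Fin 2} {N : ℕ} (h : ∀ i, N ≤ i → w i = word01 i) :
    w ∈ MulAction.orbit groupG word01 := by
  suffices e : point (prefixVal w N - prefixVal word01 N) = w from e ▸ point_mem_orbit _
  have key : ∀ k, N ≤ k → (2 : ℤ) ^ k ∣
      prefixVal (point (prefixVal w N - prefixVal word01 N)) k - prefixVal w k := by
    intro k hk
    rw [prefixVal_sub_eq_of_eq h hk]
    exact pow_dvd_prefixVal_point _ k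
  have hdig : ∀ (w : ℕ → Fin 2) (k j : ℕ), (2 : ℤ) ^ k ∣ prefixVal w (k + j) - prefixVal w k := by
    intro w k j
    induction j with
    | zero => simp
    | succ j ih =>
      rw [← add_assoc, prefixVal_succ, add_sub_right_comm]
      exact dvd_add ih ((pow_dvd_pow 2 (k.le_add_right j)).mul_left _)
  refine eq_of_prefixVal_dvd fun k => ?_
  have h1 := (pow_dvd_pow (2 : ℤ) (k.le_add_right N)).trans (key (k + N) (by omega))
  exact (dvd_sub (dvd_add h1 (hdig w k N)) (hdig _ k N)).trans (dvd_of_eq (by ring))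

/-- Adding `n` to `-2 / 3` changes only finitely many binary digits: the residue of `-2 / 3` modulo
`2 ^ k` is about `2 ^ k / 3` away from both ends of the interval `[0, 2 ^ k)`, so that no carry
occurs beyond position `k` once `2 ^ k` is large compared to `n`. -/
theorem exists_point_eq (n : ℤ) : ∃ N, ∀ i, N ≤ i → point n i = word01 i := by
  have key : ∀ k, 3 * n.natAbs + 2 ≤ k → prefixVal (point n) k = prefixVal word01 k + n := by
    intro k hk
    have h1 := prefixVal_nonneg (point n) k
    have h2 := prefixVal_lt (point n) k
    have h3 := three_mul_prefixVal_word01 k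
    have h4 : k < 2 ^ k := Nat.lt_two_pow_self
    zify at h4
    refine sub_eq_zero.1 (Int.eq_zero_of_abs_lt_dvd (pow_dvd_prefixVal_point n k) ?_)
    rcases Nat.mod_two_eq_zero_or_one (k + 1) with h | h <;> rw [h] at h3 <;> push_cast at h3 <;>
      rw [abs_lt] <;> constructor <;> omega
  exact ⟨_, fun i hi => digit_eq_of_prefixVal (key i hi) (key (i + 1) (by omega))⟩

/-- The digit described by a letter of a code: the letter `true` means the opposite of the digit `c`
of `(01)^∞` at this place, while `false` and the padding symbol mean `c` itself. -/
def codeDigit (c : Fin 2) (o : Option Bool) : Fin 2 := if o.getD false then 1 - c else c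

/-- The infinite word with a given code: the code tells where it differs from `(01)^∞`. -/
def decode (u : List Bool) : ℕ → Fin 2 := fun i => codeDigit (word01 i) u[i]?

/-- A code is canonical if it does not end in `false`. -/
def IsCanonical (u : List Bool) : Prop := u.getLast?.getD true = true

theorem one_sub_ne (c : Fin 2) : 1 - c ≠ c := by fin_cases c <;> decide

theorem decode_of_length_le {u : List Bool} {i : ℕ} (h : u.length ≤ i) :
    decode u i = word01 i := by
  rw [decode, List.getElem?_eq_none h]; rfl

theorem codeDigit_eq_iff {c : Fin 2} {o o' : Option Bool} :
    codeDigit c o = codeDigit c o' ↔ o.getD false = o'.getD false := by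
  rw [codeDigit, codeDigit]
  have := one_sub_ne c
  cases o.getD false <;> cases o'.getD false <;> simp [this, this.symm]

theorem isCanonical_iff_getElem? {u : List Bool} :
    IsCanonical u ↔ u[u.length - 1]?.getD true = true := by
  rw [IsCanonical, List.getLast?_eq_getElem?]

theorem length_le_of_decode_eq {u v : List Bool} (hv : IsCanonical v) (h : decode u = decode v) :
    v.length ≤ u.length := by
  by_contra hlt
  rw [isCanonical_iff_getElem?, List.getElem?_eq_getElem (by omega)] at hv
  have h1 := codeDigit_eq_iff.1 (congrFun h (v.length - 1))
  rw [List.getElem?_eq_none (by omega), List.getElem?_eq_getElem (by omega)] at h1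
  simp only [Option.getD_some, Option.getD_none] at h1 hv
  rw [hv] at h1
  exact Bool.noConfusion h1

theorem eq_of_decode_eq {u v : List Bool} (hu : IsCanonical u) (hv : IsCanonical v)
    (h : decode u = decode v) : u = v := by
  have hl := le_antisymm (length_le_of_decode_eq hu h.symm) (length_le_of_decode_eq hv h)
  refine List.ext_getElem hl fun i h1 h2 => ?_
  have := codeDigit_eq_iff.1 (congrFun h i)
  rwa [List.getElem?_eq_getElem h1, List.getElem?_eq_getElem h2] at this

theorem exists_isCanonical_decode_eq {w : ℕ → Fin 2} {N : ℕ} (h : ∀ i, N ≤ i → w i = word01 i) :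
    ∃ u, IsCanonical u ∧ decode u = w := by
  induction N with
  | zero => exact ⟨[], rfl, funext fun i => (h i i.zero_le).symm ▸ rfl⟩
  | succ N ih =>
    by_cases hN : w N = word01 N
    · refine ih fun i hi => ?_
      rcases hi.eq_or_lt with rfl | hi
      · exact hN
      · exact h i hi
    · refine ⟨(List.range (N + 1)).map fun i => decide (w i ≠ word01 i), ?_, funext fun i => ?_⟩
      · rw [isCanonical_iff_getElem?]
        simp [hN]
      · rcases lt_or_ge i (N + 1) with hi | hi
        · have e : ∀ x c : Fin 2, codeDigit c (some (decide (x ≠ c))) = x := by decide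
          rw [decode, List.getElem?_map, List.getElem?_range hi]
          exact e _ _
        · rw [h i hi, decode_of_length_le (by simpa using hi)]

theorem exists_code (x : MulAction.orbit groupG word01) :
    ∃ u, IsCanonical u ∧ decode u = (x : ℕ → Fin 2) := by
  obtain ⟨n, hn⟩ := mem_range_point_of_mem_orbit x.2
  obtain ⟨N, hN⟩ := exists_point_eq n
  exact exists_isCanonical_decode_eq (hn ▸ hN)

/-- The canonical code of a point of the orbit of `(01)^∞`. -/
noncomputable def vertexCode (x : MulAction.orbit groupG word01) : List Bool := (exists_code x).choose

theorem isCanonical_vertexCode (x : MulAction.orbit groupG word01) : IsCanonical (vertexCode x) :=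
  (exists_code x).choose_spec.1

theorem decode_vertexCode (x : MulAction.orbit groupG word01) :
    decode (vertexCode x) = (x : ℕ → Fin 2) := (exists_code x).choose_spec.2

theorem exists_vertexCode_eq {u : List Bool} (hu : IsCanonical u) : ∃ x, vertexCode x = u :=
  ⟨⟨decode u, mem_orbit_of_eventually_eq fun _ h => decode_of_length_le h⟩,
    eq_of_decode_eq (isCanonical_vertexCode _) hu (decode_vertexCode _)⟩

theorem range_vertexCode : Set.range vertexCode = {u | IsCanonical u} := by
  ext u
  exact ⟨fun ⟨x, hx⟩ => hx ▸ isCanonical_vertexCode x, exists_vertexCode_eq⟩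

/-! ### Automata recognizing codes and edges -/

/-- The automaton that remembers the last letter read. -/
def lastLetterDFA : DFA Bool Bool where
  step _ x := x
  start := true
  accept := {true}

theorem eval_lastLetterDFA (u : List Bool) : lastLetterDFA.eval u = u.getLast?.getD true := by
  induction u using List.reverseRecOn with
  | nil => rfl
  | append_singleton u x _ => rw [DFA.eval_append_singleton, List.getLast?_append]; rfl

theorem isRegular_isCanonical : Language.IsRegular ({u | IsCanonical u} : Language Bool) := by
  refine ⟨Bool, inferInstance, lastLetterDFA, ?_⟩
  ext u
  rw [DFA.mem_accepts, eval_lastLetterDFA]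
  rfl

/-- The first `n` letters of the word `u` followed by padding symbols. -/
def padTo {α : Type*} (n : ℕ) (u : List α) : List (Option α) := (List.range n).map fun j => u[j]?

theorem padTo_succ {α : Type*} (n : ℕ) (u : List α) : padTo (n + 1) u = padTo n u ++ [u[n]?] := by
  rw [padTo, List.range_succ, List.map_append]; rfl

/-- The automaton that recognizes padded canonical codes. Its states are `some (some x)`, where `x`
is the last letter read, `some none` after the first padding symbol, and `none` for failure. -/
def paddedDFA : DFA (Option Bool) (Option (Option Bool)) where
  step
    | some (some _), some x => some (some x)
    | some (some true), none => some none
    | some none, none => some none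
    | _, _ => none
  start := some (some true)
  accept := {some (some true), some none}

theorem eval_paddedDFA_map_some (u : List Bool) :
    paddedDFA.eval (u.map some) = some (some (u.getLast?.getD true)) := by
  induction u using List.reverseRecOn with
  | nil => rfl
  | append_singleton u x ih =>
    rw [List.map_append, List.map_singleton, DFA.eval_append_singleton, ih, List.getLast?_append]
    rfl

theorem padTo_length {α : Type*} (u : List α) : padTo u.length u = u.map some := by
  refine List.ext_getElem (by simp [padTo]) fun i h1 h2 => ?_
  simp [padTo] at h1 ⊢

theorem eval_paddedDFA_padTo {u : List Bool} (hu : IsCanonical u) {n : ℕ} (hn : u.length < n) :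
    paddedDFA.eval (padTo n u) = some none := by
  induction n, hn using Nat.le_induction with
  | base =>
    rw [padTo_succ, padTo_length, DFA.eval_append_singleton, eval_paddedDFA_map_some, hu,
      List.getElem?_eq_none le_rfl]
    rfl
  | succ n hn ih =>
    rw [padTo_succ, DFA.eval_append_singleton, ih, List.getElem?_eq_none (by omega)]
    rfl

theorem exists_of_eval_paddedDFA (p : List (Option Bool)) :
    (∀ x, paddedDFA.eval p = some (some x) → ∃ u, p = List.map some u ∧ u.getLast?.getD true = x) ∧
    (paddedDFA.eval p = some none →
      ∃ u n, IsCanonical u ∧ u.length ≤ n ∧ p = padTo n u) := by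
  induction p using List.reverseRecOn with
  | nil => exact ⟨fun x h => ⟨[], rfl, Option.some.inj (Option.some.inj h)⟩, fun h => by cases h⟩
  | append_singleton p y ih =>
    rw [DFA.eval_append_singleton]
    constructor
    · intro x h
      generalize hs : paddedDFA.eval p = s at h ih
      rcases s with _ | _ | z
      · cases h
      · cases y <;> cases h
      · cases y with
        | none => cases z <;> cases h
        | some y =>
          cases h
          obtain ⟨u, rfl, -⟩ := ih.1 z rfl
          exact ⟨u ++ [x], by simp, by simp⟩
    · intro h
      generalize hs : paddedDFA.eval p = s at h ih
      rcases s with _ | _ | z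
      · cases h
      · cases y with
        | some y => cases h
        | none =>
          obtain ⟨u, n, h1, h2, rfl⟩ := ih.2 rfl
          exact ⟨u, n + 1, h1, by omega, by rw [padTo_succ, List.getElem?_eq_none h2]⟩
      · cases y with
        | some y => cases h
        | none =>
          cases z with
          | false => cases h
          | true =>
            obtain ⟨u, rfl, h1⟩ := ih.1 true rfl
            exact ⟨u, u.length + 1, h1, by omega,
              by rw [padTo_succ, padTo_length, List.getElem?_eq_none le_rfl]⟩

theorem mem_accepts_paddedDFA {p : List (Option Bool)} :
    p ∈ paddedDFA.accepts ↔ ∃ u n, IsCanonical u ∧ u.length ≤ n ∧ p = padTo n u := by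
  rw [DFA.mem_accepts]
  constructor
  · rintro (h | h)
    · obtain ⟨u, h1, h2⟩ := (exists_of_eval_paddedDFA p).1 _ h
      exact ⟨u, u.length, h2, le_rfl, h1.trans (padTo_length u).symm⟩
    · exact (exists_of_eval_paddedDFA p).2 h
  · rintro ⟨u, n, hu, hn, rfl⟩
    rcases hn.eq_or_lt with rfl | hn
    · left; rw [padTo_length, eval_paddedDFA_map_some, hu]
    · right; exact eval_paddedDFA_padTo hu hn

/-- The automaton that checks whether all letters satisfy `P`. -/
def allDFA {α : Type*} (P : α → Prop) : DFA α Prop where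
  step s x := s ∧ P x
  start := True
  accept := {s | s}

theorem eval_allDFA {α : Type*} (P : α → Prop) (w : List α) :
    (allDFA P).eval w ↔ ∀ x ∈ w, P x := by
  induction w using List.reverseRecOn with
  | nil => exact iff_of_true trivial (by simp)
  | append_singleton w x ih =>
    rw [DFA.eval_append_singleton]
    change (allDFA P).eval w ∧ P x ↔ _
    rw [ih]
    simp [or_imp, forall_and]

/-- The automaton that checks whether the second code of a pair is the image of the first one under
the state `q`. It runs the automaton from `q`, with `none` for a mismatch, and keeps track of the
current digit of `(01)^∞`; at the end, there must not be anything left to do. -/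
def transducerDFA (q : AState) : DFA (Option Bool × Option Bool) (Option AState × Fin 2) where
  step s x :=
    (s.1.bind fun r =>
      if automatonA.out r (codeDigit s.2 x.1) = codeDigit s.2 x.2 then
        some (automatonA.next r (codeDigit s.2 x.1)) else none, 1 - s.2)
  start := (some q, 0)
  accept := {s | s.1 = some .e}

/-- The first `n` letters of the convolution of two words followed by pairs of padding symbols. For
`n` the larger of the two lengths, this is the convolution. -/
def zipTo {α : Type*} (n : ℕ) (u v : List α) : List (Option α × Option α) :=
  (List.range n).map fun j => (u[j]?, v[j]?)

theorem zipTo_succ {α : Type*} (n : ℕ) (u v : List α) :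
    zipTo (n + 1) u v = zipTo n u v ++ [(u[n]?, v[n]?)] := by
  rw [zipTo, List.range_succ, List.map_append]; rfl

theorem eval_transducerDFA (q : AState) (u v : List Bool) (n : ℕ) :
    ((transducerDFA q).eval (zipTo n u v)).2 = word01 n ∧
    ∀ r, ((transducerDFA q).eval (zipTo n u v)).1 = some r ↔
      automatonA.stateAt q (decode u) n = r ∧
        ∀ i < n, automatonA.act q (decode u) i = decode v i := by
  induction n with
  | zero => exact ⟨rfl, fun r => by simp [zipTo, transducerDFA, InvertibleMealy.stateAt]⟩
  | succ n ih =>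
    obtain ⟨ih1, ih2⟩ := ih
    rw [zipTo_succ, DFA.eval_append_singleton]
    refine ⟨?_, fun r => ?_⟩
    · rw [word01_succ, ← ih1]; rfl
    · change ((transducerDFA q).eval (zipTo n u v)).1.bind _ = some r ↔ _
      rw [Option.bind_eq_some_iff]
      simp only [ih2, ih1]
      constructor
      · rintro ⟨_, ⟨rfl, h1⟩, h2⟩
        split_ifs at h2 with h3
        refine ⟨Option.some.inj h2, fun i hi => ?_⟩
        rcases Nat.lt_succ_iff_lt_or_eq.1 hi with hi | rfl
        · exact h1 i hi
        · exact h3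
      · rintro ⟨h1, h2⟩
        refine ⟨_, ⟨rfl, fun i hi => h2 i (by omega)⟩, ?_⟩
        exact (if_pos (h2 n n.lt_succ_self)).trans (congrArg some h1)

/-- The states `a` and `b` change every tail of `(01)^∞`. -/
theorem stateAt_eq_e {q : AState} {w w' : ℕ → Fin 2} {n : ℕ} (hw : ∀ i, n ≤ i → w i = word01 i)
    (hw' : ∀ i, n ≤ i → w' i = word01 i) (h : automatonA.act q w = w') :
    automatonA.stateAt q w n = .e := by
  have ha : ∀ i, n ≤ i → automatonA.stateAt q w i ≠ .a := by
    intro i hi hs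
    have h1 := congrFun h i
    rw [hw' i hi, ← hw i hi, InvertibleMealy.act, hs] at h1
    rcases digit_eq (w i) with ⟨h0, -⟩ | ⟨h0, -⟩ <;> rw [h0] at h1 <;> exact absurd h1 (by decide)
  have hb : ∀ i, n ≤ i → w i = 1 → automatonA.stateAt q w i ≠ .b := by
    intro i hi h1 hs
    exact ha (i + 1) (by omega) (by rw [InvertibleMealy.stateAt, hs, h1]; rfl)
  cases hs : automatonA.stateAt q w n with
  | e => rfl
  | a => exact absurd hs (ha n le_rfl)
  | b =>
    rcases digit_eq (w n) with ⟨h0, -⟩ | ⟨h0, -⟩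
    · refine absurd ?_ (hb (n + 1) (by omega) ?_)
      · rw [InvertibleMealy.stateAt, hs, h0]; rfl
      · rw [hw _ (by omega), word01_succ, ← hw n le_rfl, h0]; rfl
    · exact absurd hs (hb n le_rfl h0)

theorem mem_accepts_transducerDFA {q : AState} {u v : List Bool} {n : ℕ} (hu : u.length ≤ n)
    (hv : v.length ≤ n) :
    zipTo n u v ∈ (transducerDFA q).accepts ↔ automatonA.act q (decode u) = decode v := by
  rw [DFA.mem_accepts]
  refine ((eval_transducerDFA q u v n).2 .e).trans ⟨fun ⟨hs, h⟩ => funext fun i => ?_, fun h => ?_⟩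
  · rcases lt_or_ge i n with hi | hi
    · exact h i hi
    · have hsi : automatonA.stateAt q (decode u) i = .e := by
        induction i, hi using Nat.le_induction with
        | base => exact hs
        | succ i _ ih => rw [InvertibleMealy.stateAt, ih]; rfl
      rw [InvertibleMealy.act, hsi, out_e, decode_of_length_le (hu.trans hi),
        decode_of_length_le (hv.trans hi)]
  · exact ⟨stateAt_eq_e (fun i hi => decode_of_length_le (hu.trans hi))
      (fun i hi => decode_of_length_le (hv.trans hi)) h, fun i _ => congrFun h i⟩

instance : Finite AState :=
  Finite.of_injective (fun s : AState => match s with | .e => (0 : Fin 3) | .a => 1 | .b => 2) (by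
    intro s t h
    cases s <;> cases t <;> first | rfl | exact absurd h (by decide))

/-- A word over pairs is a convolution of canonical codes if both its projections are padded
canonical codes and no letter consists of two padding symbols. -/
theorem mem_convolution_iff {w : List (Option Bool × Option Bool)} {q : AState} :
    (∃ u v, (IsCanonical u ∧ IsCanonical v ∧ automatonA.act q (decode u) = decode v) ∧
      convolution u v = w) ↔
    ((w ∈ (paddedDFA.comap Prod.fst).accepts ∧ w ∈ (paddedDFA.comap Prod.snd).accepts) ∧
      w ∈ (allDFA fun x => x ≠ (none, none)).accepts) ∧ w ∈ (transducerDFA q).accepts := by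
  have hfst : w ∈ (paddedDFA.comap Prod.fst).accepts ↔ w.map Prod.fst ∈ paddedDFA.accepts := by
    rw [DFA.accepts_comap]; rfl
  have hsnd : w ∈ (paddedDFA.comap Prod.snd).accepts ↔ w.map Prod.snd ∈ paddedDFA.accepts := by
    rw [DFA.accepts_comap]; rfl
  have hall : w ∈ (allDFA fun x => x ≠ (none, none)).accepts ↔ ∀ x ∈ w, x ≠ (none, none) :=
    eval_allDFA _ w
  rw [hfst, hsnd, hall, mem_accepts_paddedDFA, mem_accepts_paddedDFA]
  constructor
  · rintro ⟨u, v, ⟨hu, hv, h⟩, rfl⟩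
    refine ⟨⟨⟨⟨u, _, hu, le_max_left _ v.length, ?_⟩, ⟨v, _, hv, le_max_right u.length _, ?_⟩⟩, ?_⟩,
      (mem_accepts_transducerDFA (le_max_left _ _) (le_max_right _ _)).2 h⟩
    · rw [convolution, List.map_map]; rfl
    · rw [convolution, List.map_map]; rfl
    · intro x hx h0
      obtain ⟨j, hj, rfl⟩ := List.mem_map.1 hx
      rw [Prod.mk.injEq, List.getElem?_eq_none_iff, List.getElem?_eq_none_iff] at h0
      rw [List.mem_range] at hj
      omega
  · rintro ⟨⟨⟨⟨u, n, hu, hun, h1⟩, ⟨v, m, hv, hvm, h2⟩⟩, h3⟩, h4⟩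
    have hn : w.length = n := by simpa [padTo] using congrArg List.length h1
    have hm : w.length = m := by simpa [padTo] using congrArg List.length h2
    subst hn
    subst hm
    have hw : w = zipTo w.length u v := by
      refine List.ext_getElem (by simp [zipTo]) fun i hi _ => ?_
      have e1 := congrArg (fun l => l[i]?) h1
      have e2 := congrArg (fun l => l[i]?) h2
      simp [padTo, hi] at e1 e2
      simp [zipTo, ← e1, ← e2]
    have hlen : w.length = max u.length v.length := by
      refine le_antisymm (not_lt.1 fun hlt => ?_) (max_le hun hvm)
      refine h3 (none, none) ?_ rfl
      rw [hw]
      refine List.mem_map.2 ⟨max u.length v.length, List.mem_range.2 hlt, ?_⟩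
      rw [List.getElem?_eq_none (le_max_left _ _), List.getElem?_eq_none (le_max_right _ _)]
    have hw' := hw
    rw [hw, mem_accepts_transducerDFA hun hvm] at h4
    rw [hlen] at hw'
    exact ⟨u, v, ⟨hu, hv, h4⟩, hw'.symm⟩

theorem isRegularRel_act (q : AState) : IsRegularRel fun u v : List Bool =>
    IsCanonical u ∧ IsCanonical v ∧ automatonA.act q (decode u) = decode v := by
  have h1 : (paddedDFA.comap (Prod.fst : Option Bool × Option Bool → _)).accepts.IsRegular :=
    ⟨_, inferInstance, _, rfl⟩
  have h2 : (paddedDFA.comap (Prod.snd : Option Bool × Option Bool → _)).accepts.IsRegular :=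
    ⟨_, inferInstance, _, rfl⟩
  have h3 : (allDFA fun x : Option Bool × Option Bool => x ≠ (none, none)).accepts.IsRegular :=
    ⟨_, inferInstance, _, rfl⟩
  have h4 : (transducerDFA q).accepts.IsRegular := ⟨_, Fintype.ofFinite _, _, rfl⟩
  have h := ((h1.inf h2).inf h3).inf h4
  rw [IsRegularRel]
  refine Eq.mpr (congrArg Language.IsRegular ?_) h
  ext w
  exact mem_convolution_iff

theorem map_edge_eq {s : ({genA, genB} : Set groupG)} {q : AState}
    (hs : ((s : groupG) : Equiv.Perm (ℕ → Fin 2)) = automatonA.perm q) :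
    Relation.Map ((orbitalGraph word01).Edge s) vertexCode vertexCode = fun u v =>
      IsCanonical u ∧ IsCanonical v ∧ automatonA.act q (decode u) = decode v := by
  have key : ∀ x y, (orbitalGraph word01).Edge s x y ↔
      automatonA.act q (x : ℕ → Fin 2) = (y : ℕ → Fin 2) := by
    intro x y
    change (s : groupG) • x = y ↔ _
    rw [Subtype.ext_iff]
    change ((s : groupG) : Equiv.Perm (ℕ → Fin 2)) (x : ℕ → Fin 2) = _ ↔ _
    rw [hs]; rfl
  funext u v
  refine propext ⟨?_, ?_⟩
  · rintro ⟨x, y, h, rfl, rfl⟩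
    refine ⟨isCanonical_vertexCode x, isCanonical_vertexCode y, ?_⟩
    rwa [decode_vertexCode, decode_vertexCode, ← key]
  · rintro ⟨hu, hv, h⟩
    obtain ⟨x, rfl⟩ := exists_vertexCode_eq hu
    obtain ⟨y, rfl⟩ := exists_vertexCode_eq hv
    rw [decode_vertexCode, decode_vertexCode, ← key] at h
    exact ⟨x, y, h, rfl, rfl⟩

theorem isAutomatic_orbitalGraph : (orbitalGraph word01).IsAutomatic := by
  refine ⟨Bool, inferInstance, vertexCode, fun x y h => Subtype.ext ?_, ?_, ?_⟩
  · rw [← decode_vertexCode, h, decode_vertexCode]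
  · rw [range_vertexCode]; exact isRegular_isCanonical
  · rintro ⟨s, rfl | rfl⟩
    · rw [map_edge_eq (q := .a) rfl]; exact isRegularRel_act _
    · rw [map_edge_eq (q := .b) rfl]; exact isRegularRel_act _

theorem theorem1 :
    Infinite (MulAction.orbit groupG word01) ∧
    (∀ x, (orbitalGraph word01).degree x = 4) ∧
    (∀ x, ((orbitalGraph word01).toSimpleGraph.neighborSet x).encard = 4) ∧
    (orbitalGraph word01).IsAutomatic ∧
    ∀ x, IsIntermediateGrowth ((orbitalGraph word01).growth x) ∧
      (∀ ε : ℝ, 0 < ε → ∀ᶠ n : ℕ in atTop,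
        (n : ℝ) ^ ((1 / 2 - ε) * Real.logb 2 n) ≤ ((orbitalGraph word01).growth x n : ℝ)) ∧
      ∃ C : ℝ, 0 < C ∧ ∀ n : ℕ, 1 ≤ n →
        ((orbitalGraph word01).growth x n : ℝ) ≤ C * (n : ℝ) ^ Real.logb 2 n := by
  exact ⟨Infinite.of_injective orbitEquiv orbitEquiv.injective, degree_orbitalGraph,
    encard_neighborSet_orbitalGraph, isAutomatic_orbitalGraph, fun x =>
    ⟨isIntermediateGrowth_growth x, fun _ hε => eventually_le_growth x hε, growth_le x⟩⟩
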